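/- Let $b\ge 2$ be an integer. Let $\mathcal M^\flat$ be the set of Borel probability measures $\rho$ on $[0,1]$ that have an essentially bounded density with respect to Lebesgue measure on $[0,1]$ and satisfy $\rho([1-\frac1b,1])>0$. For $\rho\in\mathcal M^\flat$ let $\mathbb P=\rho^{\mathbb N}$, let $X_1,X_2,\dots$ be i.i.d. with law $\rho$, and put $Q_0^{(\theta)}=\theta$, $Q_{n+1}^{(\theta)}=X_{n+1}+\frac1b Q_n^{(\theta)}$ and $$Z_n(\theta)=\mathbb P\bigl(Q_k^{(\theta)}\ge 1,\ k=0,\dots,n\bigr).$$ Let $\mathfrak z(\rho)=\lim_{n\to\infty}Z_n(\theta)^{1/n}$ for $\theta\ge1$, let $x_\star=\sup\{y\in[0,1]:\rho([y,1])>0\}$ and $\theta_b=\theta_b(\rho)=\frac{b}{b-1}x_\star$. Let $Y=(Y_1,Y_2,\dots)$ have law $\mathbb P$, put $Q_{n,k}^{(\theta)}=\sum_{j=k}^n b^{-(j-k)}Y_j+\theta b^{-(n-k+1)}$ for $1\le k\le n$, and let $\mathbb P_n^{(\theta)}=\mathbb P(\,\cdot\mid Q_{n,\ell}^{(\theta)}\ge1,\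 \ell=2,\dots,n)$. Let $\widehat{\mathbb P}$ be the probability measure on sequences with $\widehat{\mathbb P}(E)=\lim_{n\to\infty}\mathbb P_n^{(\theta)}(E)$ for all $\theta\ge1$ and all events $E$ depending on finitely many $Y_k$, and let $Q_\infty=\sum_{k\ge1}Y_k b^{-(k-1)}$. Then for every $\rho\in\mathcal M^\flat$ the limit $\mathfrak z(\rho)$ exists and does not depend on $\theta\ge1$, the measure $\widehat{\mathbb P}$ exists and is unique, and $$\mathfrak z(\rho)=\widehat{\mathbb P}(Q_\infty\ge1).$$ Moreover, the limit $\psi_\rho(\theta)=\lim_{n\to\infty}Z_n(\theta)\,\mathfrak z(\rho)^{-n}$ exists for all $\theta\ge0$, and for all $\theta_0>\theta_b(\rho)$ there are $A'=A'(\rho,\theta_0)<\infty$ and $\zeta'=\zeta'(\rho)>0$ such that $$\bigl|Z_n(\theta)\,\mathfrak z(\rho)^{-n}-\psi_\rho(\theta)\bigr|\le A'e^{-\zeta' n}\qquad\text{for all }\theta\in[0,\theta_0]\text{ and all }n\ge1.$$ Furthermore: (1) $\psi_\rho(\theta)\in(0,\infty)$ for all $\theta\ge1$, while $\psi_\rho(\theta)=0$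 for $\theta<1$. (2) $\psi_\rho$ is non-decreasing on $[1,\infty)$, and for all $\theta_0>\theta_b(\rho)$ there is $C=C(\rho,\theta_0)<\infty$ such that $|\psi_\rho(\theta)-\psi_\rho(\theta')|\le C\,\psi_\rho(\theta_0)\,|\theta-\theta'|$ for all $\theta,\theta'\in[1,\theta_0]$. (3) If $\rho,\rho'\in\mathcal M^\flat$ and $\rho_\alpha=(1-\alpha)\rho+\alpha\rho'$, then for every $\theta\ge0$ the map $\alpha\mapsto\psi_{\rho_\alpha}(\theta)$ is continuous on $[0,1]$. The quantities $A'(\rho,\theta_0)$, $\zeta'(\rho)$ and $C(\rho,\theta_0)$ can be chosen (as functions on $\mathcal M^\flat$) so that they are bounded away from infinity and zero uniformly on every convex hull $\mathcal N\subset\mathcal M^\flat$ of finitely many elements of $\mathcal M^\flat$; for $A'$ and $C$ this means: for each fixed $\theta_0$, uniformly over those $\rho\in\mathcal N$ with $\theta_b(\rho)<\theta_0$. -/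

import Mathlib

open MeasureTheory Filter Topology
open scoped ENNReal NNReal

namespace Avalanche

/-- The class `𝓜♭` of Borel probability measures on `[0,1]` (regarded as measures on `ℝ`) which have
an essentially bounded density with respect to Lebesgue measure on `[0,1]` and which give positive
mass to `[1 - 1/b, 1]`. -/
def BoundedDensity (b : ℕ) : Set (ProbabilityMeasure ℝ) :=
  {ρ | (∃ φ : ℝ → ℝ≥0∞, Measurable φ ∧
          (ρ : Measure ℝ) = (volume.restrict (Set.Icc (0 : ℝ) 1)).withDensity φ ∧
          ∃ M : ℝ≥0, ∀ᵐ x ∂(volume.restrict (Set.Icc (0 : ℝ) 1)), φ x ≤ (M : ℝ≥0∞)) ∧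
        0 < (ρ : Measure ℝ) (Set.Icc (1 - 1 / (b : ℝ)) 1)}

/-- The law `ℙ = ρ^ℕ` of an i.i.d. sequence with one-point law `ρ`. A sequence `X₁, X₂, …` (or
`Y₁, Y₂, …`) is represented by `x : ℕ → ℝ` with `X_k = x (k - 1)`. -/
noncomputable def seqLaw (ρ : ProbabilityMeasure ℝ) : Measure (ℕ → ℝ) :=
  Measure.infinitePi (fun _ : ℕ => (ρ : Measure ℝ))

/-- `Q_n^{(θ)} = X_n + X_{n-1}/b + ⋯ + X_1/b^{n-1} + θ/b^n`, through the recursion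
`Q_0 = θ`, `Q_{n+1} = X_{n+1} + Q_n / b`. -/
noncomputable def Q (b : ℕ) (θ : ℝ) (x : ℕ → ℝ) : ℕ → ℝ
  | 0 => θ
  | n + 1 => x n + Q b θ x n / (b : ℝ)

/-- `Z_n(θ) = ℙ(Q_k^{(θ)} ≥ 1 for k = 0, …, n)`. -/
noncomputable def Z (b : ℕ) (ρ : ProbabilityMeasure ℝ) (n : ℕ) (θ : ℝ) : ℝ :=
  (seqLaw ρ).real {x | ∀ k ≤ n, 1 ≤ Q b θ x k}

/-- The functional `𝔷(ρ) = lim Z_n(1)^{1/n}`. -/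
noncomputable def z (b : ℕ) (ρ : ProbabilityMeasure ℝ) : ℝ :=
  limUnder atTop (fun n : ℕ => Z b ρ n 1 ^ (1 / (n : ℝ)))

/-- The function `ψ_ρ(θ) = lim Z_n(θ) 𝔷(ρ)^{-n}`. -/
noncomputable def psi (b : ℕ) (ρ : ProbabilityMeasure ℝ) (θ : ℝ) : ℝ :=
  limUnder atTop (fun n : ℕ => Z b ρ n θ * (z b ρ ^ n)⁻¹)

/-- The maximum `x_⋆` of the support of `ρ`. -/
noncomputable def xStar (ρ : ProbabilityMeasure ℝ) : ℝ :=
  sSup {y : ℝ | y ∈ Set.Icc (0 : ℝ) 1 ∧ 0 < (ρ : Measure ℝ) (Set.Icc y 1)}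

/-- `θ_b = b / (b - 1) * x_⋆`. -/
noncomputable def thetaB (b : ℕ) (ρ : ProbabilityMeasure ℝ) : ℝ :=
  (b : ℝ) / ((b : ℝ) - 1) * xStar ρ

/-- `Q_{n,k}^{(θ)} = Y_k + Y_{k+1}/b + ⋯ + Y_n/b^{n-k} + θ/b^{n-k+1}` for `1 ≤ k ≤ n`. -/
noncomputable def revQ (b : ℕ) (θ : ℝ) (n k : ℕ) (y : ℕ → ℝ) : ℝ :=
  (∑ j ∈ Finset.Icc k n, y (j - 1) / (b : ℝ) ^ (j - k)) + θ / (b : ℝ) ^ (n - k + 1)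

/-- The conditional law `ℙ_n^{(θ)} = ℙ( · | Q_{n,ℓ}^{(θ)} ≥ 1, ℓ = 2, …, n)`. -/
noncomputable def condLaw (b : ℕ) (ρ : ProbabilityMeasure ℝ) (n : ℕ) (θ : ℝ) : Measure (ℕ → ℝ) :=
  ProbabilityTheory.cond (seqLaw ρ) {y | ∀ l ∈ Finset.Icc 2 n, 1 ≤ revQ b θ n l y}

/-- `μ` is the limit law `lim ℙ_n^{(θ)}`, for every `θ ≥ 1`: the probabilities of all events that
depend on finitely many coordinates `Y_1, …, Y_k` converge. -/
def IsLimitLaw (b : ℕ) (ρ : ProbabilityMeasure ℝ) (μ : ProbabilityMeasure (ℕ → ℝ)) : Prop :=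
  ∀ θ : ℝ, 1 ≤ θ → ∀ (k : ℕ) (B : Set (Fin k → ℝ)), MeasurableSet B →
    Tendsto (fun n : ℕ => (condLaw b ρ n θ).real {y | (fun i : Fin k => y i) ∈ B}) atTop
      (𝓝 ((μ : Measure (ℕ → ℝ)).real {y | (fun i : Fin k => y i) ∈ B}))

/-- `Q_∞ = ∑_{k ≥ 1} Y_k / b^{k-1}`. -/
noncomputable def Qinf (b : ℕ) (y : ℕ → ℝ) : ℝ :=
  ∑' k : ℕ, y k / (b : ℝ) ^ k

/-- The convex combination `ρ_α = (1 - α) ρ + α ρ'`, for `α ∈ [0,1]`. -/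
noncomputable def mix (ρ ρ' : ProbabilityMeasure ℝ) (α : Set.Icc (0 : ℝ) 1) :
    ProbabilityMeasure ℝ :=
  ⟨ENNReal.ofReal (1 - (α : ℝ)) • (ρ : Measure ℝ) + ENNReal.ofReal (α : ℝ) • (ρ' : Measure ℝ), by
    constructor
    simp only [Measure.coe_add, Measure.coe_smul, Pi.add_apply, Pi.smul_apply, measure_univ,
      smul_eq_mul, mul_one]
    rw [← ENNReal.ofReal_add (by linarith [α.2.2]) α.2.1]
    simp⟩

/-- The convex hull of finitely many probability measures `σ_0, …, σ_{m-1}`. -/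
def hull {m : ℕ} (σ : Fin m → ProbabilityMeasure ℝ) : Set (ProbabilityMeasure ℝ) :=
  {ρ | ∃ w : Fin m → ℝ≥0, ∑ i, w i = 1 ∧
        (ρ : Measure ℝ) = ∑ i, w i • (σ i : Measure ℝ)}

end Avalanche

namespace Avalanche

/-! By the Markov property `Z b ρ n` is the indicator of `[1, ∞)` times `survival b ρ n`, written
W_n, the `n`-th iterate of `1` under the positive operator `step`. The heart of the proof is a
Perron–Frobenius statement for this operator, `exists_condMean_rate`: for monotone Lipschitz `f` the
quotient of `step^n f` by W_n converges exponentially fast to a constant that does not depend on the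
starting point. All rates depend on `ρ` only through the bound `M` on the density and the lower
bound `p` on the mass of `[1 - 1/b, 1]`.

Two facts give the contraction. First, W_n is Lipschitz relative to its own size, uniformly in `n`
(`Regular.survival_sub_le`): a step divides distances by `b`, and the bounded density makes it
unlikely that the threshold separates two nearby paths. A Harnack inequality on bounded intervals
follows. Second, run the chain from θ' < θ with the same innovation (`Regular.abs_div_sub_div_le`).
A fraction r = W(θ')/W(θ) of the weight is carried by pairs that both survive, now `b` times closer;
the rest costs at most the oscillation D of the conditional mean. As 1 - r is at most a constant
times θ - θ', the conditional mean becomes Lipschitz with constant of order D, so at very small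
distances its increments are at most D/2. As r is bounded below, this gain spreads, doubling its
range at each step, to all pairs in the absorbing interval `[1, 3]`. A fixed number of steps thus
multiplies D by some γ < 1 (`exists_block_contraction`).

With f = W_1 this gives the convergence of W_{n+1}/W_n to `z`, and summing increments gives `psi`.
With `f` the probability that the time-reversed chain survives and a cylinder event occurs, it gives
the convergence of `condLaw`; compactness, together with domination by the i.i.d. law, produces the
limit law. Moreover W_{n+1}/W_n is the conditional probability of the one missing constraint ℓ = 1.
Since Y_1 is independent of the conditioning and has a bounded density, partial sums of `Qinf` put
little mass just below 1, and `z` is identified in the limit. Finally, the bounds by `M` and `p`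
survive convex combinations, which yields uniformity on hulls and, through uniform limits,
continuity in α. -/

/-- A quantitative form of membership in `BoundedDensity b`: the density is at most `M`, and
`[1 - 1/b, 1]` has mass at least `p`. -/
structure Regular (b : ℕ) (M p : ℝ) (ρ : ProbabilityMeasure ℝ) : Prop where
  two_le : 2 ≤ b
  pos : 0 < p
  ae_mem : ∀ᵐ x ∂(ρ : Measure ℝ), x ∈ Set.Icc (0 : ℝ) 1
  Ico_le : ∀ a c : ℝ, a ≤ c → (ρ : Measure ℝ).real (Set.Ico a c) ≤ M * (c - a)
  le_mass : p ≤ (ρ : Measure ℝ).real (Set.Icc (1 - 1 / (b : ℝ)) 1)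

/-- Monotone functions with values in `[0, 1]`. -/
structure UnitMonotone (f : ℝ → ℝ) : Prop where
  mono : Monotone f
  nonneg : ∀ x, 0 ≤ f x
  le_one : ∀ x, f x ≤ 1

/-- The transition operator of the chain `Q`, killed below `1`. -/
noncomputable def step (b : ℕ) (ρ : ProbabilityMeasure ℝ) (f : ℝ → ℝ) (θ : ℝ) : ℝ :=
  ∫ x, (Set.Ici (1 : ℝ)).indicator f (x + θ / (b : ℝ)) ∂(ρ : Measure ℝ)

/-- The survival probability of the killed chain, before taking the starting point into account. -/
noncomputable def survival (b : ℕ) (ρ : ProbabilityMeasure ℝ) (n : ℕ) : ℝ → ℝ :=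
  (step b ρ)^[n] 1

/-! ### The killed transition operator: comparison, Lipschitz and Harnack estimates. -/

section Basic

variable {b : ℕ} {M p : ℝ} {ρ : ProbabilityMeasure ℝ} {f w : ℝ → ℝ}

/-- All the mass lies in `[0, 2)`. Used to know that `M` is positive. -/
lemma Regular.half_le (h : Regular b M p ρ) : 1 / 2 ≤ M := by
  have h1 := h.Ico_le 0 2 (by norm_num)
  have h2 : (ρ : Measure ℝ).real (Set.Ico (0 : ℝ) 2) = 1 := by
    rw [measureReal_def, show (ρ : Measure ℝ) (Set.Ico (0 : ℝ) 2) = 1 from ?_]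
    · simp
    · rw [← mem_ae_iff_prob_eq_one measurableSet_Ico]
      filter_upwards [h.ae_mem] with x hx
      exact ⟨hx.1, hx.2.trans_lt (by norm_num)⟩
  linarith

lemma Regular.two_le_cast (h : Regular b M p ρ) : (2 : ℝ) ≤ b := by exact_mod_cast h.two_le

lemma UnitMonotone.one : UnitMonotone 1 :=
  ⟨monotone_const, fun _ => zero_le_one, fun _ => le_rfl⟩

lemma UnitMonotone.indicator (hf : UnitMonotone f) :
    UnitMonotone ((Set.Ici (1 : ℝ)).indicator f) where
  mono := by
    intro x y hxy
    by_cases hx : x ∈ Set.Ici (1 : ℝ)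
    · have hy : y ∈ Set.Ici (1 : ℝ) := le_trans hx hxy
      simpa [hx, hy] using hf.mono hxy
    · simpa [hx] using Set.indicator_nonneg (fun x _ => hf.nonneg x) y
  nonneg := Set.indicator_nonneg (fun x _ => hf.nonneg x)
  le_one := fun x => Set.indicator_le' (fun x _ => hf.le_one x) (fun _ _ => zero_le_one) x

lemma UnitMonotone.integrable_add (hf : UnitMonotone f) (t : ℝ) :
    Integrable (fun x => f (x + t)) (ρ : Measure ℝ) := by
  refine Integrable.of_bound (C := 1) ?_ (ae_of_all _ fun x => ?_)
  · exact (hf.mono.comp (monotone_id.add_const t)).measurable.aestronglyMeasurable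
  · rw [Real.norm_eq_abs, abs_of_nonneg (hf.nonneg _)]
    exact hf.le_one _

lemma UnitMonotone.integrable (hf : UnitMonotone f) (t : ℝ) :
    Integrable (fun x => (Set.Ici (1 : ℝ)).indicator f (x + t)) (ρ : Measure ℝ) :=
  hf.indicator.integrable_add t

lemma UnitMonotone.step (hf : UnitMonotone f) (b : ℕ) (ρ : ProbabilityMeasure ℝ) :
    UnitMonotone (step b ρ f) where
  mono := by
    intro x y hxy
    refine integral_mono (hf.integrable _) (hf.integrable _) fun t => hf.indicator.mono ?_
    have : x / (b : ℝ) ≤ y / b := by gcongr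
    linarith
  nonneg := fun x => integral_nonneg fun t => hf.indicator.nonneg _
  le_one := fun x => by
    calc Avalanche.step b ρ f x ≤ ∫ _, (1 : ℝ) ∂(ρ : Measure ℝ) :=
          integral_mono (hf.integrable _) (integrable_const _) fun t => hf.indicator.le_one _
      _ = 1 := by simp

lemma UnitMonotone.iterate (hf : UnitMonotone f) (b : ℕ) (ρ : ProbabilityMeasure ℝ) (n : ℕ) :
    UnitMonotone ((Avalanche.step b ρ)^[n] f) := by
  induction n with
  | zero => exact hf
  | succ n ih => rw [Function.iterate_succ_apply']; exact ih.step b ρ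

lemma survival_unitMonotone (b : ℕ) (ρ : ProbabilityMeasure ℝ) (n : ℕ) :
    UnitMonotone (survival b ρ n) := UnitMonotone.one.iterate b ρ n

lemma survival_zero (b : ℕ) (ρ : ProbabilityMeasure ℝ) : survival b ρ 0 = 1 := rfl

lemma survival_succ (b : ℕ) (ρ : ProbabilityMeasure ℝ) (n : ℕ) :
    survival b ρ (n + 1) = step b ρ (survival b ρ n) := Function.iterate_succ_apply' _ _ _

lemma iterate_survival (b : ℕ) (ρ : ProbabilityMeasure ℝ) (m n : ℕ) :
    (step b ρ)^[m] (survival b ρ n) = survival b ρ (m + n) :=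
  (Function.iterate_add_apply _ m n _).symm

lemma Regular.ae_mem_Icc (h : Regular b M p ρ) {a θ : ℝ} (hθ : θ / b + 1 ≤ a) :
    ∀ᵐ x ∂(ρ : Measure ℝ), x + θ / b ≤ a := by
  filter_upwards [h.ae_mem] with x hx
  linarith [hx.2]

/-- From θ the chain moves to at most θ/b + 1, and positions below 1 are killed, so a comparison on
`[1, a]` is all that one step sees. -/
lemma Regular.step_le (h : Regular b M p ρ) (hf : UnitMonotone f) (hw : UnitMonotone w)
    {a c θ : ℝ} (hfw : ∀ q, 1 ≤ q → q ≤ a → f q ≤ c * w q) (hθ : θ / b + 1 ≤ a) :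
    step b ρ f θ ≤ c * step b ρ w θ := by
  unfold step
  rw [← integral_const_mul]
  refine integral_mono_ae (hf.integrable _) ((hw.integrable _).const_mul c) ?_
  filter_upwards [h.ae_mem_Icc hθ] with x hx
  by_cases h1 : x + θ / (b : ℝ) ∈ Set.Ici (1 : ℝ)
  · simpa [h1] using hfw _ h1 hx
  · simp [h1]

lemma Regular.le_step (h : Regular b M p ρ) (hf : UnitMonotone f) (hw : UnitMonotone w)
    {a c θ : ℝ} (hfw : ∀ q, 1 ≤ q → q ≤ a → c * w q ≤ f q) (hθ : θ / b + 1 ≤ a) :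
    c * step b ρ w θ ≤ step b ρ f θ := by
  unfold step
  rw [← integral_const_mul]
  refine integral_mono_ae ((hw.integrable _).const_mul c) (hf.integrable _) ?_
  filter_upwards [h.ae_mem_Icc hθ] with x hx
  by_cases h1 : x + θ / (b : ℝ) ∈ Set.Ici (1 : ℝ)
  · simpa [h1] using hfw _ h1 hx
  · simp [h1]

lemma Regular.iterate_le (h : Regular b M p ρ) (hf : UnitMonotone f) (hw : UnitMonotone w)
    {c : ℝ} (hfw : ∀ q, 1 ≤ q → f q ≤ c * w q) (n : ℕ) :
    ∀ θ, 1 ≤ θ → (step b ρ)^[n] f θ ≤ c * (step b ρ)^[n] w θ := by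
  induction n with
  | zero => exact hfw
  | succ n ih =>
    intro θ _
    simp only [Function.iterate_succ_apply']
    exact h.step_le (hf.iterate b ρ n) (hw.iterate b ρ n) (fun q hq _ => ih q hq) le_rfl

lemma Regular.le_iterate (h : Regular b M p ρ) (hf : UnitMonotone f) (hw : UnitMonotone w)
    {c : ℝ} (hfw : ∀ q, 1 ≤ q → c * w q ≤ f q) (n : ℕ) :
    ∀ θ, 1 ≤ θ → c * (step b ρ)^[n] w θ ≤ (step b ρ)^[n] f θ := by
  induction n with
  | zero => exact hfw
  | succ n ih =>
    intro θ _
    simp only [Function.iterate_succ_apply']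
    exact h.le_step (hf.iterate b ρ n) (hw.iterate b ρ n) (fun q hq _ => ih q hq) le_rfl

lemma Regular.div_le_sub (h : Regular b M p ρ) {θ : ℝ} (hθ : θ ≤ 3) : θ / b + 1 ≤ 3 := by
  have h2 := h.two_le_cast
  have : θ / b ≤ 3 / 2 := by
    rw [div_le_div_iff₀ (by linarith) (by norm_num)]
    nlinarith
  linarith

/-- The interval `[1, 3]` is absorbing, so bounds on it are preserved by the operator. -/
lemma Regular.le_iterate_of_le_three (h : Regular b M p ρ) (hf : UnitMonotone f)
    (hw : UnitMonotone w) {c : ℝ} (hfw : ∀ q, 1 ≤ q → q ≤ 3 → c * w q ≤ f q) (n : ℕ) :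
    ∀ θ, 1 ≤ θ → θ ≤ 3 → c * (step b ρ)^[n] w θ ≤ (step b ρ)^[n] f θ := by
  induction n with
  | zero => exact hfw
  | succ n ih =>
    intro θ _ h3
    simp only [Function.iterate_succ_apply']
    exact h.le_step (hf.iterate b ρ n) (hw.iterate b ρ n) ih (h.div_le_sub h3)

lemma Regular.iterate_le_of_le_three (h : Regular b M p ρ) (hf : UnitMonotone f)
    (hw : UnitMonotone w) {c : ℝ} (hfw : ∀ q, 1 ≤ q → q ≤ 3 → f q ≤ c * w q) (n : ℕ) :
    ∀ θ, 1 ≤ θ → θ ≤ 3 → (step b ρ)^[n] f θ ≤ c * (step b ρ)^[n] w θ := by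
  induction n with
  | zero => exact hfw
  | succ n ih =>
    intro θ _ h3
    simp only [Function.iterate_succ_apply']
    exact h.step_le (hf.iterate b ρ n) (hw.iterate b ρ n) ih (h.div_le_sub h3)

/-- An innovation in `[1 - 1/b, 1]` keeps every path started at θ ≥ 1 above the threshold. This is
where the positive mass near the top enters. -/
lemma Regular.mass_mul_le_step (h : Regular b M p ρ) (hf : UnitMonotone f) {θ : ℝ} (hθ : 1 ≤ θ) :
    p * f 1 ≤ step b ρ f θ := by
  have hb := h.two_le_cast
  calc p * f 1 ≤ (ρ : Measure ℝ).real (Set.Icc (1 - 1 / (b : ℝ)) 1) * f 1 :=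
        mul_le_mul_of_nonneg_right h.le_mass (hf.nonneg 1)
    _ = ∫ x, (Set.Icc (1 - 1 / (b : ℝ)) 1).indicator (fun _ => f 1) x ∂(ρ : Measure ℝ) := by
        rw [integral_indicator measurableSet_Icc]; simp
    _ ≤ step b ρ f θ := by
        refine integral_mono ((integrable_const _).indicator measurableSet_Icc) (hf.integrable _) ?_
        intro x
        by_cases hx : x ∈ Set.Icc (1 - 1 / (b : ℝ)) 1
        · have h1 : 1 ≤ x + θ / b := by
            have : 1 / (b : ℝ) ≤ θ / b := by gcongr
            linarith [hx.1]
          have h2 : x + θ / b ∈ Set.Ici (1 : ℝ) := h1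
          rw [Set.indicator_of_mem hx]
          change f 1 ≤ (Set.Ici (1 : ℝ)).indicator f (x + θ / b)
          rw [Set.indicator_of_mem h2]
          exact hf.mono h1
        · rw [Set.indicator_of_notMem hx]
          exact hf.indicator.nonneg _

lemma Regular.pow_le_survival (h : Regular b M p ρ) (n : ℕ) {θ : ℝ} (hθ : 1 ≤ θ) :
    p ^ n ≤ survival b ρ n θ := by
  induction n generalizing θ with
  | zero => simp [survival_zero]
  | succ n ih =>
    rw [survival_succ, pow_succ']
    exact (mul_le_mul_of_nonneg_left (ih le_rfl) h.pos.le).trans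
      (h.mass_mul_le_step (survival_unitMonotone b ρ n) hθ)

lemma Regular.survival_pos (h : Regular b M p ρ) (n : ℕ) {θ : ℝ} (hθ : 1 ≤ θ) :
    0 < survival b ρ n θ := (pow_pos h.pos n).trans_le (h.pow_le_survival n hθ)

/-- Lipschitz estimate for the survival probability at nearby points, by induction on time. -/
lemma Regular.survival_sub_le_of_le (h : Regular b M p ρ) (n : ℕ) :
    ∀ {θ' θ : ℝ}, 1 ≤ θ' → θ' ≤ θ → θ - θ' ≤ p / (4 * M) →
      survival b ρ n θ - survival b ρ n θ' ≤ 2 * M / p * (θ - θ') * survival b ρ n θ := by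
  have hb := h.two_le_cast
  have hM := h.half_le
  have hp := h.pos
  have ha : 0 < 2 * M / p := by positivity
  induction n with
  | zero =>
    intro θ' θ _ h2 _
    simp only [survival_zero, Pi.one_apply, sub_self, mul_one]
    exact mul_nonneg ha.le (by linarith)
  | succ n ih =>
    intro θ' θ h1 h2 h3
    set w := survival b ρ n with hw
    have hwm : UnitMonotone w := survival_unitMonotone b ρ n
    set δ := θ - θ' with hδ
    have hδ0 : 0 ≤ δ := by linarith
    have hdb : θ / b - θ' / b = δ / b := by rw [hδ]; ring
    have hδb : δ / b ≤ δ / 2 := by gcongr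
    have hδb0 : 0 ≤ δ / b := by positivity
    -- the value just above the killing threshold
    have hnear : w (1 + δ / b) ≤ 2 * w 1 := by
      have := ih (θ' := 1) (θ := 1 + δ / b) le_rfl (by linarith) (by linarith)
      have h4 : 2 * M / p * (1 + δ / b - 1) ≤ 1 / 2 := by
        calc 2 * M / p * (1 + δ / b - 1) ≤ 2 * M / p * (p / (4 * M)) := by
              gcongr; linarith
          _ = 1 / 2 := by field_simp; norm_num
      have h5 : 2 * M / p * (1 + δ / b - 1) * w (1 + δ / b) ≤ 1 / 2 * w (1 + δ / b) :=
        mul_le_mul_of_nonneg_right h4 (hwm.nonneg _)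
      linarith
    -- If both paths survive, the induction hypothesis applies at distance δ/b. If only the upper
    -- one does, `x` lies in an interval of length δ/b and the path lands in `[1, 1 + δ/b]`, where
    -- `w` is at most `2 * w 1`.
    have hpt : ∀ x : ℝ, (Set.Ici (1 : ℝ)).indicator w (x + θ / b) ≤
        (Set.Ici (1 : ℝ)).indicator w (x + θ' / b) +
        2 * M / p * (δ / b) * (Set.Ici (1 : ℝ)).indicator w (x + θ / b) +
        (Set.Ico (1 - θ / b) (1 - θ' / b)).indicator (fun _ => 2 * w 1) x := by
      intro x
      by_cases hx' : 1 ≤ x + θ' / b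
      · have hx : 1 ≤ x + θ / b := by linarith
        have e1 : x + θ' / b ∈ Set.Ici (1 : ℝ) := hx'
        have e2 : x + θ / b ∈ Set.Ici (1 : ℝ) := hx
        have e3 : x ∉ Set.Ico (1 - θ / b) (1 - θ' / b) := fun hh => by linarith [hh.2]
        rw [Set.indicator_of_mem e1, Set.indicator_of_mem e2, Set.indicator_of_notMem e3]
        have := ih (θ' := x + θ' / b) (θ := x + θ / b) hx' (by linarith) (by linarith)
        have e4 : x + θ / b - (x + θ' / b) = δ / b := by linarith
        rw [e4] at this
        linarith
      · have e1 : x + θ' / b ∉ Set.Ici (1 : ℝ) := hx'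
        rw [Set.indicator_of_notMem e1]
        by_cases hx : 1 ≤ x + θ / b
        · have e2 : x + θ / b ∈ Set.Ici (1 : ℝ) := hx
          have e3 : x ∈ Set.Ico (1 - θ / b) (1 - θ' / b) := ⟨by linarith, by linarith [not_le.1 hx']⟩
          rw [Set.indicator_of_mem e2, Set.indicator_of_mem e3]
          have e5 : w (x + θ / b) ≤ w (1 + δ / b) := hwm.mono (by linarith [not_le.1 hx'])
          have e6 : 0 ≤ 2 * M / p * (δ / b) * w (x + θ / b) :=
            mul_nonneg (mul_nonneg ha.le hδb0) (hwm.nonneg _)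
          linarith
        · have e2 : x + θ / b ∉ Set.Ici (1 : ℝ) := hx
          rw [Set.indicator_of_notMem e2]
          have : 0 ≤ (Set.Ico (1 - θ / b) (1 - θ' / b)).indicator (fun _ => 2 * w 1) x :=
            Set.indicator_nonneg (fun _ _ => by linarith [hwm.nonneg 1]) x
          linarith
    have hint : step b ρ w θ ≤ step b ρ w θ' + 2 * M / p * (δ / b) * step b ρ w θ +
        (ρ : Measure ℝ).real (Set.Ico (1 - θ / b) (1 - θ' / b)) * (2 * w 1) := by
      have i1 := hwm.integrable (ρ := ρ) (θ / b)
      have i2 := hwm.integrable (ρ := ρ) (θ' / b)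
      have i3 : Integrable ((Set.Ico (1 - θ / b) (1 - θ' / b)).indicator (fun _ => 2 * w 1))
          (ρ : Measure ℝ) := (integrable_const _).indicator measurableSet_Ico
      have := integral_mono i1 ((i2.add (i1.const_mul _)).add i3) hpt
      rw [integral_add' (i2.add (i1.const_mul _)) i3, integral_add' i2 (i1.const_mul _),
        integral_const_mul, integral_indicator measurableSet_Ico] at this
      simpa [step] using this
    have hmass : (ρ : Measure ℝ).real (Set.Ico (1 - θ / b) (1 - θ' / b)) * (2 * w 1) ≤
        2 * M / p * (δ / b) * step b ρ w θ := by
      have e1 := h.Ico_le (1 - θ / b) (1 - θ' / b) (by linarith)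
      have e2 : 1 - θ' / b - (1 - θ / b) = δ / b := by linarith
      rw [e2] at e1
      have e3 := h.mass_mul_le_step hwm (h1.trans h2)
      calc _ ≤ M * (δ / b) * (2 * w 1) :=
            mul_le_mul_of_nonneg_right e1 (by linarith [hwm.nonneg 1])
        _ = 2 * M / p * (δ / b) * (p * w 1) := by field_simp
        _ ≤ _ := by gcongr
    rw [survival_succ, ← hw]
    -- Both error terms are bounded by this quantity; since `b ≥ 2`, they add up to the claimed
    -- bound with the same constant, which closes the induction.
    have hfin : 2 * M / p * (δ / b) * step b ρ w θ ≤ 2 * M / p * (δ / 2) * step b ρ w θ := by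
      have := (hwm.step b ρ).nonneg θ
      gcongr
    linarith

/-- The survival probability is Lipschitz, relative to its own size. -/
lemma Regular.survival_sub_le (h : Regular b M p ρ) (n : ℕ) {θ' θ : ℝ} (h1 : 1 ≤ θ')
    (h2 : θ' ≤ θ) :
    survival b ρ n θ - survival b ρ n θ' ≤ 4 * M / p * (θ - θ') * survival b ρ n θ := by
  have hM := h.half_le
  have hp := h.pos
  have hw := survival_unitMonotone b ρ n
  by_cases h3 : θ - θ' ≤ p / (4 * M)
  · refine (h.survival_sub_le_of_le n h1 h2 h3).trans ?_
    refine mul_le_mul_of_nonneg_right ?_ (hw.nonneg _)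
    refine mul_le_mul_of_nonneg_right ?_ (by linarith)
    gcongr
    norm_num
  -- At larger distances the prefactor exceeds 1 and the bound is trivial.
  · have : 1 ≤ 4 * M / p * (θ - θ') := by
      rw [not_le, div_lt_iff₀ (by positivity)] at h3
      rw [div_mul_eq_mul_div, le_div_iff₀ hp]
      linarith
    have := mul_le_mul_of_nonneg_right this (hw.nonneg θ)
    linarith [hw.nonneg θ']

/-- Harnack inequality for the survival probability. -/
lemma Regular.survival_le_two_pow (h : Regular b M p ρ) (n j : ℕ) :
    ∀ {θ : ℝ}, 1 ≤ θ → θ ≤ 1 + j * (p / (4 * M)) →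
      survival b ρ n θ ≤ 2 ^ j * survival b ρ n 1 := by
  have hM := h.half_le
  have hp := h.pos
  have hw := survival_unitMonotone b ρ n
  induction j with
  | zero =>
    intro θ h1 h2
    have : θ = 1 := le_antisymm (by simpa using h2) h1
    simp [this]
  | succ j ih =>
    intro θ h1 h2
    have hδ : 0 < p / (4 * M) := by positivity
    -- One step back by `p / (4 * M)`, truncated at 1; over this distance the survival probability
    -- at most doubles.
    set θ' := max 1 (θ - p / (4 * M)) with hθ'
    have e1 : θ' ≤ θ := max_le h1 (by linarith)
    have e2 : θ - θ' ≤ p / (4 * M) := by linarith [le_max_right 1 (θ - p / (4 * M))]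
    have e3 : θ' ≤ 1 + j * (p / (4 * M)) := by
      refine max_le ?_ ?_
      · have : (0 : ℝ) ≤ j * (p / (4 * M)) := by positivity
        linarith
      · push_cast at h2
        linarith
    have e4 := h.survival_sub_le_of_le n (le_max_left _ _) e1 e2
    have e5 : 2 * M / p * (θ - θ') ≤ 1 / 2 := by
      calc 2 * M / p * (θ - θ') ≤ 2 * M / p * (p / (4 * M)) := by gcongr
        _ = 1 / 2 := by field_simp; norm_num
    have e6 := mul_le_mul_of_nonneg_right e5 (hw.nonneg θ)
    have e7 := ih (le_max_left _ _) e3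
    rw [pow_succ]
    linarith

end Basic

/-- A Harnack constant for the survival probability on `[1, a]`. -/
noncomputable def harnack (M p a : ℝ) : ℝ := 2 ^ (⌈(a - 1) * (4 * M / p)⌉₊ + 1)

lemma two_le_harnack (M p a : ℝ) : 2 ≤ harnack M p a := by
  unfold harnack
  rw [pow_succ]
  linarith [one_le_pow₀ (n := ⌈(a - 1) * (4 * M / p)⌉₊) (one_le_two (α := ℝ))]

lemma Regular.survival_le_harnack {b : ℕ} {M p : ℝ} {ρ : ProbabilityMeasure ℝ}
    (h : Regular b M p ρ) (n : ℕ) {a θ : ℝ} (h1 : 1 ≤ θ) (ha : θ ≤ a) :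
    survival b ρ n θ ≤ harnack M p a * survival b ρ n 1 := by
  have hM := h.half_le
  have hp := h.pos
  refine h.survival_le_two_pow n _ h1 ?_
  have e1 := Nat.le_ceil ((a - 1) * (4 * M / p))
  have hδ : 0 < p / (4 * M) := by positivity
  have e2 : (a - 1) * (4 * M / p) * (p / (4 * M)) = a - 1 := by field_simp
  have e3 := mul_le_mul_of_nonneg_right e1 hδ.le
  push_cast
  nlinarith

/-! ### Coupling and contraction of conditional means on `[1, 3]`. -/

section Contraction

variable {b : ℕ} {M p : ℝ} {ρ : ProbabilityMeasure ℝ} {f w : ℝ → ℝ}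

/-- The basic coupling estimate: one step of the normalised operator, run with the same
innovation from two starting points. -/
lemma Regular.abs_div_sub_div_le (h : Regular b M p ρ) (hf : UnitMonotone f)
    (hw : UnitMonotone w) (hpos : ∀ q, 1 ≤ q → 0 < w q) {c D ε θ' θ : ℝ} (h1 : 1 ≤ θ')
    (h2 : θ' ≤ θ) (h3 : θ ≤ 3)
    (hc : ∀ q, 1 ≤ q → q ≤ 3 → c * w q ≤ f q ∧ f q ≤ (c + D) * w q)
    (hε : ∀ q' q, 1 ≤ q' → q' ≤ q → q ≤ 3 → q - q' = (θ - θ') / b →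
      |f q / w q - f q' / w q'| ≤ ε) :
    |step b ρ f θ / step b ρ w θ - step b ρ f θ' / step b ρ w θ'| ≤
      step b ρ w θ' / step b ρ w θ * ε + (1 - step b ρ w θ' / step b ρ w θ) * D := by
  have hb := h.two_le_cast
  have hA' : 0 < step b ρ w θ' :=
    (mul_pos h.pos (hpos 1 le_rfl)).trans_le (h.mass_mul_le_step hw h1)
  have hAA : step b ρ w θ' ≤ step b ρ w θ := (hw.step b ρ).mono h2
  have hA : 0 < step b ρ w θ := hA'.trans_le hAA
  have hdb : θ / b - θ' / b = (θ - θ') / b := by ring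
  have hδb0 : 0 ≤ (θ - θ') / b := div_nonneg (by linarith) (by linarith)
  have hq3 := h.ae_mem_Icc (h.div_le_sub h3)
  have i1 := hf.integrable (ρ := ρ) (θ / b)
  have i2 := hf.integrable (ρ := ρ) (θ' / b)
  have i3 := hw.integrable (ρ := ρ) (θ / b)
  have i4 := hw.integrable (ρ := ρ) (θ' / b)
  -- Write f = G w. Split `w q` into `w q'`, where G differs by at most ε between `q` and `q'`, and
  -- the excess `w q - w q'`, where only c ≤ G ≤ c + D is used. If the lower path is killed, the
  -- whole of `w q` is excess.
  have key : ∀ᵐ x ∂(ρ : Measure ℝ),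
      (Set.Ici (1 : ℝ)).indicator f (x + θ / b) ≤ (Set.Ici (1 : ℝ)).indicator f (x + θ' / b) +
        (ε - c - D) * (Set.Ici (1 : ℝ)).indicator w (x + θ' / b) +
        (c + D) * (Set.Ici (1 : ℝ)).indicator w (x + θ / b) ∧
      (Set.Ici (1 : ℝ)).indicator f (x + θ' / b) +
        (-(c + ε)) * (Set.Ici (1 : ℝ)).indicator w (x + θ' / b) +
        c * (Set.Ici (1 : ℝ)).indicator w (x + θ / b) ≤
        (Set.Ici (1 : ℝ)).indicator f (x + θ / b) := by
    filter_upwards [hq3] with x hx3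
    by_cases hx' : 1 ≤ x + θ' / b
    · have hx : 1 ≤ x + θ / b := by linarith
      have e1 : x + θ' / b ∈ Set.Ici (1 : ℝ) := hx'
      have e2 : x + θ / b ∈ Set.Ici (1 : ℝ) := hx
      simp only [Set.indicator_of_mem e1, Set.indicator_of_mem e2]
      set q := x + θ / b with hq
      set q' := x + θ' / b with hq'
      have hqq : q' ≤ q := by linarith
      have hG := hε q' q hx' hqq hx3 (by linarith)
      have hcq := hc q hx hx3
      have hwq := hpos q hx
      have hwq' := hpos q' hx'
      have hmono : w q' ≤ w q := hw.mono hqq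
      obtain ⟨G, hGf⟩ : ∃ G, f q / w q = G := ⟨_, rfl⟩
      obtain ⟨G', hGf'⟩ : ∃ G, f q' / w q' = G := ⟨_, rfl⟩
      rw [hGf, hGf', abs_le] at hG
      rw [div_eq_iff hwq.ne'] at hGf
      rw [div_eq_iff hwq'.ne'] at hGf'
      rw [hGf] at hcq
      rw [hGf, hGf']
      have g1 : c ≤ G := le_of_mul_le_mul_right hcq.1 hwq
      have g2 : G ≤ c + D := le_of_mul_le_mul_right hcq.2 hwq
      constructor
      · nlinarith [mul_nonneg (sub_nonneg.2 hmono) (sub_nonneg.2 g2),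
          mul_nonneg hwq'.le (by linarith : 0 ≤ G' + ε - G)]
      · nlinarith [mul_nonneg (sub_nonneg.2 hmono) (sub_nonneg.2 g1),
          mul_nonneg hwq'.le (by linarith : 0 ≤ G + ε - G')]
    · have e1 : x + θ' / b ∉ Set.Ici (1 : ℝ) := hx'
      by_cases hx : 1 ≤ x + θ / b
      · have e2 : x + θ / b ∈ Set.Ici (1 : ℝ) := hx
        simp only [Set.indicator_of_notMem e1, Set.indicator_of_mem e2]
        have := hc _ hx hx3
        constructor <;> linarith
      · have e2 : x + θ / b ∉ Set.Ici (1 : ℝ) := hx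
        simp [Set.indicator_of_notMem e1, Set.indicator_of_notMem e2]
  have up : step b ρ f θ ≤ step b ρ f θ' + (ε - c - D) * step b ρ w θ' +
      (c + D) * step b ρ w θ := by
    have := integral_mono_ae i1 ((i2.add (i4.const_mul _)).add (i3.const_mul _))
      (key.mono fun x hx => hx.1)
    rwa [integral_add' (i2.add (i4.const_mul _)) (i3.const_mul _),
      integral_add' i2 (i4.const_mul _), integral_const_mul, integral_const_mul] at this
  have low : step b ρ f θ' + (-(c + ε)) * step b ρ w θ' + c * step b ρ w θ ≤ step b ρ f θ := by
    have := integral_mono_ae ((i2.add (i4.const_mul _)).add (i3.const_mul _)) i1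
      (key.mono fun x hx => hx.2)
    rwa [integral_add' (i2.add (i4.const_mul _)) (i3.const_mul _),
      integral_add' i2 (i4.const_mul _), integral_const_mul, integral_const_mul] at this
  have lo' : c * step b ρ w θ' ≤ step b ρ f θ' :=
    h.le_step hf hw (fun q hq hq3 => (hc q hq hq3).1) (h.div_le_sub (h2.trans h3))
  have up' : step b ρ f θ' ≤ (c + D) * step b ρ w θ' :=
    h.step_le hf hw (fun q hq hq3 => (hc q hq hq3).2) (h.div_le_sub (h2.trans h3))
  generalize step b ρ w θ' = A' at *
  generalize step b ρ w θ = A at *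
  generalize step b ρ f θ' = B' at *
  generalize step b ρ f θ = B at *
  obtain ⟨r, hr⟩ : ∃ r, A' / A = r := ⟨_, rfl⟩
  obtain ⟨X', hX'⟩ : ∃ X', B' / A' = X' := ⟨_, rfl⟩
  obtain ⟨X, hX⟩ : ∃ X, B / A = X := ⟨_, rfl⟩
  rw [hr, hX, hX']
  rw [div_eq_iff hA.ne'] at hr hX
  rw [div_eq_iff hA'.ne'] at hX'
  subst hX hX' hr
  have hr1 : r ≤ 1 := by nlinarith
  have g1 : c ≤ X' := le_of_mul_le_mul_right lo' hA'
  have g2 : X' ≤ c + D := le_of_mul_le_mul_right up' hA'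
  have up2 : X ≤ X' * r + (ε - c - D) * r + (c + D) := by
    refine le_of_mul_le_mul_right ?_ hA
    linarith
  have low2 : X' * r + (-(c + ε)) * r + c ≤ X := by
    refine le_of_mul_le_mul_right ?_ hA
    linarith
  rw [abs_le]
  constructor
  · nlinarith [mul_nonneg (sub_nonneg.2 hr1) (sub_nonneg.2 g2)]
  · nlinarith [mul_nonneg (sub_nonneg.2 hr1) (sub_nonneg.2 g1)]

/-- On `[1, 3]`, the function `F` has oscillation at most `D` and Lipschitz constant at most `K`. -/
structure OscLip (F : ℝ → ℝ) (D K : ℝ) : Prop where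
  osc : ∃ c, ∀ q, 1 ≤ q → q ≤ 3 → c ≤ F q ∧ F q ≤ c + D
  lip : ∀ q' q, 1 ≤ q' → q' ≤ q → q ≤ 3 → |F q - F q'| ≤ K * (q - q')

lemma OscLip.nonneg {F : ℝ → ℝ} {D K : ℝ} (h : OscLip F D K) : 0 ≤ D := by
  obtain ⟨c, hc⟩ := h.osc
  have := hc 1 le_rfl (by norm_num)
  linarith [this.1, this.2]

/-- The expectation of `f` along the killed chain, conditioned on survival. -/
noncomputable def condMean (b : ℕ) (ρ : ProbabilityMeasure ℝ) (f : ℝ → ℝ) (n : ℕ) (θ : ℝ) : ℝ :=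
  (step b ρ)^[n] f θ / survival b ρ n θ

lemma Regular.le_condMean_iff (h : Regular b M p ρ) {c θ : ℝ} {n : ℕ} (hθ : 1 ≤ θ) :
    c ≤ condMean b ρ f n θ ↔ c * survival b ρ n θ ≤ (step b ρ)^[n] f θ :=
  le_div_iff₀ (h.survival_pos n hθ)

lemma Regular.condMean_le_iff (h : Regular b M p ρ) {c θ : ℝ} {n : ℕ} (hθ : 1 ≤ θ) :
    condMean b ρ f n θ ≤ c ↔ (step b ρ)^[n] f θ ≤ c * survival b ρ n θ :=
  div_le_iff₀ (h.survival_pos n hθ)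

/-- Bounds on the conditional mean over `[1, 3]` persist. -/
lemma Regular.condMean_mem_of_le (h : Regular b M p ρ) (hf : UnitMonotone f) {c D : ℝ} {n : ℕ}
    (hc : ∀ q, 1 ≤ q → q ≤ 3 → c ≤ condMean b ρ f n q ∧ condMean b ρ f n q ≤ c + D)
    {m : ℕ} (hnm : n ≤ m) :
    ∀ q, 1 ≤ q → q ≤ 3 → c ≤ condMean b ρ f m q ∧ condMean b ρ f m q ≤ c + D := by
  obtain ⟨k, rfl⟩ := Nat.exists_eq_add_of_le' hnm
  intro q h1 h3
  rw [h.le_condMean_iff h1, h.condMean_le_iff h1, ← iterate_survival, Function.iterate_add_apply]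
  constructor
  · refine h.le_iterate_of_le_three (hf.iterate b ρ n) (survival_unitMonotone b ρ n)
      (fun q h1 h3 => ?_) k q h1 h3
    exact (h.le_condMean_iff h1).1 (hc q h1 h3).1
  · refine h.iterate_le_of_le_three (hf.iterate b ρ n) (survival_unitMonotone b ρ n)
      (fun q h1 h3 => ?_) k q h1 h3
    exact (h.condMean_le_iff h1).1 (hc q h1 h3).2

/-- The coupling estimate for conditional means. -/
lemma Regular.abs_condMean_succ_sub_le (h : Regular b M p ρ) (hf : UnitMonotone f) {c D ε : ℝ}
    {n : ℕ} (hc : ∀ q, 1 ≤ q → q ≤ 3 → c ≤ condMean b ρ f n q ∧ condMean b ρ f n q ≤ c + D)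
    {θ' θ : ℝ} (h1 : 1 ≤ θ') (h2 : θ' ≤ θ) (h3 : θ ≤ 3)
    (hε : ∀ q' q, 1 ≤ q' → q' ≤ q → q ≤ 3 → q - q' = (θ - θ') / b →
      |condMean b ρ f n q - condMean b ρ f n q'| ≤ ε) :
    ∃ r, (harnack M p 3)⁻¹ ≤ r ∧ 1 - 4 * M / p * (θ - θ') ≤ r ∧ r ≤ 1 ∧
      |condMean b ρ f (n + 1) θ - condMean b ρ f (n + 1) θ'| ≤ r * ε + (1 - r) * D := by
  have hpos : ∀ q, 1 ≤ q → 0 < survival b ρ n q := fun q hq => h.survival_pos n hq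
  have hθ := h.survival_pos (n + 1) (h1.trans h2)
  have hH : 0 < harnack M p 3 := by linarith [two_le_harnack M p 3]
  refine ⟨survival b ρ (n + 1) θ' / survival b ρ (n + 1) θ, ?_, ?_, ?_, ?_⟩
  · rw [le_div_iff₀ hθ, inv_mul_le_iff₀ hH]
    refine (h.survival_le_harnack (n + 1) (h1.trans h2) h3).trans ?_
    exact mul_le_mul_of_nonneg_left ((survival_unitMonotone b ρ _).mono h1) hH.le
  · rw [le_div_iff₀ hθ]
    linarith [h.survival_sub_le (n + 1) h1 h2]
  · rw [div_le_one hθ]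
    exact (survival_unitMonotone b ρ _).mono h2
  · have := h.abs_div_sub_div_le (hf.iterate b ρ n) (survival_unitMonotone b ρ n) hpos h1 h2 h3
      (c := c) (D := D) (ε := ε)
      (fun q q1 q3 => ⟨(h.le_condMean_iff q1).1 (hc q q1 q3).1,
        (h.condMean_le_iff q1).1 (hc q q1 q3).2⟩) hε
    simpa only [condMean, survival_succ, Function.iterate_succ_apply'] using this

/-- Jointly surviving paths are `b` times closer, whence `K / b`; the lost weight is at most `4 * M
/ p` times the distance and costs `D`. -/
lemma Regular.oscLip_succ (h : Regular b M p ρ) (hf : UnitMonotone f) {D K : ℝ} {n : ℕ}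
    (ho : OscLip (condMean b ρ f n) D K) (hK : 0 ≤ K) :
    OscLip (condMean b ρ f (n + 1)) D (K / b + 4 * M / p * D) where
  osc := by
    obtain ⟨c, hc⟩ := ho.osc
    exact ⟨c, h.condMean_mem_of_le hf hc (Nat.le_succ n)⟩
  lip := by
    intro θ' θ h1 h2 h3
    obtain ⟨c, hc⟩ := ho.osc
    have hD := ho.nonneg
    have hb := h.two_le_cast
    obtain ⟨r, -, hr2, hr3, hr⟩ := h.abs_condMean_succ_sub_le hf hc h1 h2 h3
      (ε := K * ((θ - θ') / b)) (fun q' q a1 a2 a3 a4 => a4 ▸ ho.lip q' q a1 a2 a3)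
    have e1 : 0 ≤ K * ((θ - θ') / b) :=
      mul_nonneg hK (div_nonneg (by linarith) (by linarith))
    have e2 : r * (K * ((θ - θ') / b)) ≤ K * ((θ - θ') / b) := mul_le_of_le_one_left e1 hr3
    have e3 : (1 - r) * D ≤ 4 * M / p * (θ - θ') * D :=
      mul_le_mul_of_nonneg_right (by linarith) hD
    calc _ ≤ _ := hr
      _ ≤ K * ((θ - θ') / b) + 4 * M / p * (θ - θ') * D := add_le_add e2 e3
      _ = _ := by ring

/-- Iteration of K ↦ K/2 + L D with L = `4 * M / p`, whose fixed point is 2 L D: in the long run the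
slope is controlled by the oscillation alone. -/
lemma Regular.oscLip_add (h : Regular b M p ρ) (hf : UnitMonotone f) {D K : ℝ} {n : ℕ}
    (ho : OscLip (condMean b ρ f n) D K) (hK : 0 ≤ K) (j : ℕ) :
    OscLip (condMean b ρ f (n + j)) D (K / 2 ^ j + 2 * (4 * M / p) * D) := by
  have hM := h.half_le
  have hp := h.pos
  have hb := h.two_le_cast
  have hD := ho.nonneg
  induction j with
  | zero =>
    refine ⟨ho.osc, fun q' q h1 h2 h3 => (ho.lip q' q h1 h2 h3).trans ?_⟩
    refine mul_le_mul_of_nonneg_right ?_ (by linarith)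
    have : 0 ≤ 2 * (4 * M / p) * D := by positivity
    simpa using this
  | succ j ih =>
    have hK' : 0 ≤ K / 2 ^ j + 2 * (4 * M / p) * D := by positivity
    have := h.oscLip_succ hf ih hK'
    refine ⟨this.osc, fun q' q h1 h2 h3 => (this.lip q' q h1 h2 h3).trans ?_⟩
    refine mul_le_mul_of_nonneg_right ?_ (by linarith)
    calc _ ≤ (K / 2 ^ j + 2 * (4 * M / p) * D) / 2 + 4 * M / p * D := by gcongr
      _ = _ := by rw [pow_succ]; ring

/-- Contraction of the oscillation at larger and larger distances. -/
lemma Regular.abs_condMean_sub_le_of_sub_le (h : Regular b M p ρ) (hf : UnitMonotone f)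
    {D K τ : ℝ} {n : ℕ} (ho : OscLip (condMean b ρ f n) D K) (hK : 0 ≤ K) (hτ : K * τ ≤ D / 2)
    (j : ℕ) :
    ∀ θ' θ, 1 ≤ θ' → θ' ≤ θ → θ ≤ 3 → θ - θ' ≤ 2 ^ j * τ →
      |condMean b ρ f (n + j) θ - condMean b ρ f (n + j) θ'| ≤
        D - (harnack M p 3)⁻¹ ^ j * (D / 2) := by
  have hb := h.two_le_cast
  have hD := ho.nonneg
  have hH : 0 < (harnack M p 3)⁻¹ := inv_pos.2 (by linarith [two_le_harnack M p 3])
  induction j with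
  | zero =>
    intro θ' θ h1 h2 h3 h4
    have := ho.lip θ' θ h1 h2 h3
    have e := mul_le_mul_of_nonneg_left (by simpa using h4 : θ - θ' ≤ τ) hK
    simp only [add_zero, pow_zero, one_mul]
    linarith
  | succ j ih =>
    intro θ' θ h1 h2 h3 h4
    obtain ⟨c, hc⟩ := (h.oscLip_add hf ho hK j).osc
    obtain ⟨r, hr1, -, -, hr⟩ := h.abs_condMean_succ_sub_le hf hc h1 h2 h3
      -- After the step the distance is at most `2 ^ j * τ`, so the previous gain applies on a
      -- fraction r of the weight, and r is at least the inverse Harnack constant.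
      (ε := D - (harnack M p 3)⁻¹ ^ j * (D / 2)) (fun q' q a1 a2 a3 a4 => ih q' q a1 a2 a3 (by
        rw [a4, div_le_iff₀ (by linarith)]
        rw [pow_succ] at h4
        have : 0 ≤ 2 ^ j * τ := by linarith
        nlinarith))
    rw [← add_assoc]
    refine hr.trans ?_
    have e1 : 0 ≤ (harnack M p 3)⁻¹ ^ j * (D / 2) := by positivity
    have := mul_le_mul_of_nonneg_right hr1 e1
    rw [pow_succ']
    linarith

end Contraction

/-! ### Exponential convergence of conditional means. -/

section Limit

variable {b : ℕ} {M p : ℝ} {ρ : ProbabilityMeasure ℝ} {f w : ℝ → ℝ}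

lemma exists_oscillation_bound {F : ℝ → ℝ} {c D : ℝ} (hc : ∀ q, 1 ≤ q → q ≤ 3 → c ≤ F q)
    (hF : ∀ q' q, 1 ≤ q' → q' ≤ q → q ≤ 3 → |F q - F q'| ≤ D) :
    ∃ c', ∀ q, 1 ≤ q → q ≤ 3 → c' ≤ F q ∧ F q ≤ c' + D := by
  have hbdd : BddBelow (F '' Set.Icc 1 3) := by
    refine ⟨c, ?_⟩
    rintro _ ⟨q, hq, rfl⟩
    exact hc q hq.1 hq.2
  have hne : (F '' Set.Icc 1 3).Nonempty := ⟨F 1, 1, ⟨le_rfl, by norm_num⟩, rfl⟩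
  refine ⟨sInf (F '' Set.Icc 1 3), fun q h1 h3 => ⟨csInf_le hbdd ⟨q, ⟨h1, h3⟩, rfl⟩, ?_⟩⟩
  rw [← sub_le_iff_le_add]
  refine le_csInf hne ?_
  rintro _ ⟨q', hq', rfl⟩
  rcases le_total q' q with hqq | hqq
  · linarith [(abs_le.1 (hF q' q hq'.1 hqq h3)).2]
  · linarith [(abs_le.1 (hF q q' h1 hqq hq'.2)).1]

/-- The invariant ties the slope to the oscillation, K = 4 L D with L = `4 * M / p`, so that the
block can be repeated with D replaced by γ D. Block length and γ depend only on `M` and `p`. -/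
lemma exists_block_contraction (M p : ℝ) :
    ∃ (m : ℕ) (γ : ℝ), 0 < m ∧ 3 / 4 ≤ γ ∧ γ < 1 ∧
      ∀ {b : ℕ} {ρ : ProbabilityMeasure ℝ}, Regular b M p ρ → ∀ {f : ℝ → ℝ}, UnitMonotone f →
        ∀ {D : ℝ} {n : ℕ}, OscLip (condMean b ρ f n) D (4 * (4 * M / p) * D) →
          OscLip (condMean b ρ f (n + m)) (γ * D) (4 * (4 * M / p) * (γ * D)) := by
  obtain ⟨m₀, hm₀⟩ := pow_unbounded_of_one_lt (16 * (4 * M / p)) (one_lt_two (α := ℝ))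
  have hη := two_le_harnack M p 3
  have hη0 : 0 < (harnack M p 3)⁻¹ := inv_pos.2 (by linarith)
  have hη2 : (harnack M p 3)⁻¹ ≤ 1 / 2 := by
    rw [inv_le_comm₀ (by linarith) (by norm_num)]
    linarith
  have hpow : (harnack M p 3)⁻¹ ^ (m₀ + 2) ≤ 1 / 2 :=
    (pow_le_of_le_one hη0.le (by linarith) (by omega)).trans hη2
  have hpow0 : 0 < (harnack M p 3)⁻¹ ^ (m₀ + 2) := pow_pos hη0 _
  refine ⟨m₀ + 2, 1 - (harnack M p 3)⁻¹ ^ (m₀ + 2) / 2, by omega, by linarith, by linarith, ?_⟩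
  intro b ρ h f hf D n ho
  have hM := h.half_le
  have hp := h.pos
  have hD := ho.nonneg
  have hLpos : 0 < 4 * M / p := by positivity
  generalize hL : 4 * M / p = L at *
  have hpow2 : 16 * L ≤ 2 ^ (m₀ + 2) := by
    rw [pow_add]
    nlinarith [pow_pos (two_pos (α := ℝ)) m₀]
  have hpow4 : (4 : ℝ) ≤ 2 ^ (m₀ + 2) := by
    rw [pow_add]
    nlinarith [one_le_pow₀ (n := m₀) (one_le_two (α := ℝ))]
  have hK : 0 ≤ 4 * L * D := by positivity
  have ho2 := h.oscLip_add hf ho hK (m₀ + 2)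
  constructor
  · obtain ⟨c, hc⟩ := ho2.osc
    refine exists_oscillation_bound (fun q h1 h3 => (hc q h1 h3).1) fun θ' θ h1 h2 h3 => ?_
    -- This τ makes K τ = D/2, and the block is long enough for `2 ^ (m₀ + 2) * τ` to reach 2, the
    -- length of `[1, 3]`.
    have := h.abs_condMean_sub_le_of_sub_le hf (τ := 1 / (8 * L)) ho hK
      (by field_simp; linarith) (m₀ + 2) θ' θ h1 h2 h3 (by
        have : 2 ≤ 2 ^ (m₀ + 2) * (1 / (8 * L)) := by
          rw [mul_one_div, le_div_iff₀ (by positivity)]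
          linarith
        linarith)
    refine this.trans (le_of_eq ?_)
    ring
  · intro q' q h1 h2 h3
    refine (ho2.lip q' q h1 h2 h3).trans (mul_le_mul_of_nonneg_right ?_ (by linarith))
    -- The new slope is at most L D + 2 L D = 3 L D, which is at most 4 L γ D because γ ≥ 3/4.
    have e1 : 4 * L * D / 2 ^ (m₀ + 2) ≤ 4 * L * D / 4 := by gcongr
    rw [hL]
    nlinarith

/-- The class of test functions: monotone, `[0, 1]`-valued, Lipschitz on `[1, 3]`. -/
structure TestFunction (M p : ℝ) (f : ℝ → ℝ) : Prop extends UnitMonotone f where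
  lip : ∀ q' q, 1 ≤ q' → q' ≤ q → q ≤ 3 → f q - f q' ≤ 4 * M / p * (q - q')

lemma TestFunction.oscLip (h : Regular b M p ρ) (hf : TestFunction M p f) :
    OscLip (condMean b ρ f 0) 1 (4 * (4 * M / p) * 1) where
  osc := ⟨0, fun q _ _ => by simpa [condMean, survival_zero] using ⟨hf.nonneg q, hf.le_one q⟩⟩
  lip := by
    intro q' q h1 h2 h3
    have hM := h.half_le
    have hp := h.pos
    have e1 := hf.lip q' q h1 h2 h3
    have e2 := hf.mono h2
    have e3 : 0 ≤ 4 * M / p * (q - q') := by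
      have : 0 ≤ q - q' := by linarith
      positivity
    simp only [condMean, survival_zero, Function.iterate_zero, id, Pi.one_apply, div_one, mul_one]
    rw [abs_of_nonneg (by linarith)]
    linarith

/-- The block contraction is interpolated with g = γ^(1/m). One interval serves all later times `N`,
since bounds on `[1, 3]` persist; this gives the Cauchy property as well as independence of the
starting point. -/
lemma exists_geometric_oscillation (M p : ℝ) :
    ∃ g : ℝ, 0 < g ∧ g < 1 ∧
      ∀ {b : ℕ} {ρ : ProbabilityMeasure ℝ}, Regular b M p ρ → ∀ {f : ℝ → ℝ}, TestFunction M p f →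
        ∀ n : ℕ, ∃ c, ∀ N, n ≤ N → ∀ q, 1 ≤ q → q ≤ 3 →
          c ≤ condMean b ρ f N q ∧ condMean b ρ f N q ≤ c + 2 * g ^ n := by
  obtain ⟨m, γ, hm, hγ, hγ1, H⟩ := exists_block_contraction M p
  have hγ0 : 0 < γ := by linarith
  have hm0 : (m : ℝ) ≠ 0 := by exact_mod_cast hm.ne'
  set g : ℝ := γ ^ (1 / (m : ℝ)) with hg
  have hgm : g ^ m = γ := by
    rw [hg, ← Real.rpow_natCast, ← Real.rpow_mul hγ0.le, one_div, inv_mul_cancel₀ hm0,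
      Real.rpow_one]
  have hg0 : 0 < g := Real.rpow_pos_of_pos hγ0 _
  have hg1 : g < 1 := Real.rpow_lt_one hγ0.le hγ1 (by positivity)
  refine ⟨g, hg0, hg1, ?_⟩
  intro b ρ h f hf n
  have hblock : ∀ k : ℕ, OscLip (condMean b ρ f (k * m)) (γ ^ k) (4 * (4 * M / p) * γ ^ k) := by
    intro k
    induction k with
    | zero => simpa using hf.oscLip h
    | succ k ih =>
      rw [pow_succ', add_mul, one_mul]
      exact H h hf.toUnitMonotone ih
  obtain ⟨c, hc⟩ := (hblock (n / m)).osc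
  refine ⟨c, fun N hN q h1 h3 => ?_⟩
  have hN' : n / m * m ≤ N := (Nat.div_mul_le_self n m).trans hN
  have := h.condMean_mem_of_le hf.toUnitMonotone hc hN' q h1 h3
  refine ⟨this.1, this.2.trans ?_⟩
  -- Rounding `n` down to a multiple of `m` loses at most a factor 1/γ ≤ 4/3, which the constant 2
  -- absorbs.
  have e1 : γ ^ (n / m) * γ ≤ g ^ n := by
    rw [← hgm, ← pow_mul, ← pow_add]
    refine pow_le_pow_of_le_one hg0.le hg1.le ?_
    have := Nat.div_add_mod n m
    have := Nat.mod_lt n hm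
    linarith
  have e2 : 0 < γ ^ (n / m) := pow_pos hγ0 _
  nlinarith

/-- Bounds on the conditional mean over `[1, 3]` extend to larger intervals after more steps. -/
lemma Regular.condMean_add_mem (h : Regular b M p ρ) (hf : UnitMonotone f) {c c' : ℝ} {n : ℕ}
    (hc : ∀ q, 1 ≤ q → q ≤ 3 → c ≤ condMean b ρ f n q ∧ condMean b ρ f n q ≤ c') (k : ℕ) :
    ∀ q, 1 ≤ q → q ≤ 2 ^ k + 2 →
      c ≤ condMean b ρ f (n + k) q ∧ condMean b ρ f (n + k) q ≤ c' := by
  induction k with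
  | zero => intro q h1 h3; exact hc q h1 (by norm_num at h3; exact h3)
  | succ k ih =>
    intro q h1 h3
    have hb := h.two_le_cast
    have hq : q / b + 1 ≤ 2 ^ k + 2 := by
      have : q / b ≤ q / 2 := by gcongr
      rw [pow_succ] at h3
      linarith
    rw [h.le_condMean_iff h1, h.condMean_le_iff h1, ← add_assoc, survival_succ,
      Function.iterate_succ_apply']
    exact ⟨h.le_step (hf.iterate b ρ _) (survival_unitMonotone b ρ _)
        (fun q h1 h3 => (h.le_condMean_iff h1).1 (ih q h1 h3).1) hq,
      h.step_le (hf.iterate b ρ _) (survival_unitMonotone b ρ _)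
        (fun q h1 h3 => (h.condMean_le_iff h1).1 (ih q h1 h3).2) hq⟩

lemma Regular.condMean_mem_Icc (h : Regular b M p ρ) (hf : UnitMonotone f) (n : ℕ) {θ : ℝ}
    (hθ : 1 ≤ θ) : condMean b ρ f n θ ∈ Set.Icc (0 : ℝ) 1 := by
  constructor
  · rw [h.le_condMean_iff hθ, zero_mul]
    exact (hf.iterate b ρ n).nonneg θ
  · rw [h.condMean_le_iff hθ]
    exact h.iterate_le hf UnitMonotone.one (fun q _ => by simpa using hf.le_one q) n θ hθ

/-- Conditional means of test functions converge exponentially fast, to a limit which does not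
depend on the starting point. -/
theorem exists_condMean_rate (M p : ℝ) :
    ∃ (g : ℝ) (K : ℝ → ℝ), 0 < g ∧ g < 1 ∧ (∀ a, 0 < K a) ∧
      ∀ {b : ℕ} {ρ : ProbabilityMeasure ℝ}, Regular b M p ρ → ∀ {f : ℝ → ℝ}, TestFunction M p f →
        ∃ l ∈ Set.Icc (0 : ℝ) 1, ∀ a θ, 1 ≤ θ → θ ≤ a → ∀ n : ℕ,
          |condMean b ρ f n θ - l| ≤ K a * g ^ n := by
  obtain ⟨g, hg0, hg1, H⟩ := exists_geometric_oscillation M p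
  -- `k a` is a number of steps after which bounds on `[1, 3]` have spread to `[1, a]`. At earlier
  -- times both quantities lie in `[0, 1]` and the constant makes the bound trivial.
  choose k hk using fun a : ℝ => pow_unbounded_of_one_lt a (one_lt_two (α := ℝ))
  refine ⟨g, fun a => 2 * (g ^ k a)⁻¹, hg0, hg1, fun a => by positivity, ?_⟩
  intro b ρ h f hf
  have hcau : CauchySeq fun n => condMean b ρ f n 1 := by
    refine cauchySeq_of_le_tendsto_0 (fun n => 2 * g ^ n) (fun N N' n hN hN' => ?_) ?_
    · obtain ⟨c, hc⟩ := H h hf n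
      have e1 := hc N hN 1 le_rfl (by norm_num)
      have e2 := hc N' hN' 1 le_rfl (by norm_num)
      rw [Real.dist_eq, abs_le]
      constructor <;> linarith [e1.1, e1.2, e2.1, e2.2]
    · simpa using (tendsto_pow_atTop_nhds_zero_of_lt_one hg0.le hg1).const_mul 2
  obtain ⟨l, hl⟩ := cauchySeq_tendsto_of_complete hcau
  have hl01 : l ∈ Set.Icc (0 : ℝ) 1 :=
    isClosed_Icc.mem_of_tendsto hl
      (Eventually.of_forall fun n => h.condMean_mem_Icc hf.toUnitMonotone n le_rfl)
  refine ⟨l, hl01, fun a θ h1 h2 n => ?_⟩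
  by_cases hn : k a ≤ n
  · obtain ⟨j, rfl⟩ := Nat.exists_eq_add_of_le' hn
    obtain ⟨c, hc⟩ := H h hf j
    have e1 : l ∈ Set.Icc c (c + 2 * g ^ j) := isClosed_Icc.mem_of_tendsto hl
      ((eventually_ge_atTop j).mono fun N hN => hc N hN 1 le_rfl (by norm_num))
    have e2 := h.condMean_add_mem hf.toUnitMonotone (hc j le_rfl) (k a) θ h1
      (by linarith [hk a])
    have e3 : 2 * (g ^ k a)⁻¹ * g ^ (j + k a) = 2 * g ^ j := by
      rw [pow_add]
      field_simp
    rw [e3, abs_le]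
    constructor <;> linarith [e1.1, e1.2, e2.1, e2.2]
  · have e1 := h.condMean_mem_Icc hf.toUnitMonotone n h1
    have e2 : |condMean b ρ f n θ - l| ≤ 1 := by
      rw [abs_le]
      constructor <;> linarith [e1.1, e1.2, hl01.1, hl01.2]
    refine e2.trans ?_
    have e3 : g ^ k a ≤ g ^ n := pow_le_pow_of_le_one hg0.le hg1.le (by omega)
    have e4 : 0 < g ^ k a := by positivity
    have e5 : 1 ≤ (g ^ k a)⁻¹ * g ^ n := by
      rw [← div_eq_inv_mul, le_div_iff₀ e4]
      linarith
    linarith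

lemma Regular.survival_testFunction (h : Regular b M p ρ) (n : ℕ) :
    TestFunction M p (survival b ρ n) where
  toUnitMonotone := survival_unitMonotone b ρ n
  lip := by
    intro q' q h1 h2 _
    refine (h.survival_sub_le n h1 h2).trans ?_
    have hM := h.half_le
    have hp := h.pos
    have : 0 ≤ q - q' := by linarith
    exact mul_le_of_le_one_right (by positivity) ((survival_unitMonotone b ρ n).le_one q)

lemma condMean_survival_one (b : ℕ) (ρ : ProbabilityMeasure ℝ) (n : ℕ) (θ : ℝ) :
    condMean b ρ (survival b ρ 1) n θ = survival b ρ (n + 1) θ / survival b ρ n θ := by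
  rw [condMean, iterate_survival]

lemma Regular.le_condMean_survival (h : Regular b M p ρ) (k n : ℕ) {θ : ℝ} (hθ : 1 ≤ θ) :
    p ^ k ≤ condMean b ρ (survival b ρ k) n θ := by
  rw [h.le_condMean_iff hθ]
  exact h.le_iterate (survival_unitMonotone b ρ k) UnitMonotone.one
    (fun q hq => by simpa using h.pow_le_survival k hq) n θ hθ

end Limit

/-! ### The decay rate and the normalised survival probability. -/

section Normalized

variable {b : ℕ} {M p : ℝ} {ρ : ProbabilityMeasure ℝ}

lemma Regular.tendsto_survival_ratio (h : Regular b M p ρ) {l : ℝ}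
    (hl : Tendsto (fun n => survival b ρ (n + 1) 1 / survival b ρ n 1) atTop (𝓝 l)) (n : ℕ) :
    Tendsto (fun m => survival b ρ (m + n) 1 / survival b ρ m 1) atTop (𝓝 (l ^ n)) := by
  induction n with
  | zero =>
    refine tendsto_const_nhds.congr fun m => ?_
    rw [pow_zero, add_zero, div_self (h.survival_pos m le_rfl).ne']
  | succ n ih =>
    rw [pow_succ']
    refine ((hl.comp (tendsto_add_atTop_nat n)).mul ih).congr fun m => ?_
    simp only [Function.comp_apply]
    have := (h.survival_pos (m + n) le_rfl).ne'
    rw [div_mul_div_cancel₀ this, add_assoc]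

/-- Run `m` steps from 1: the chain stays in `[1, 3]`, where the survival probability over the `n`
other steps is comparable with its value at 1. -/
lemma Regular.survival_add_bounds (h : Regular b M p ρ) (m n : ℕ) :
    survival b ρ n 1 * survival b ρ m 1 ≤ survival b ρ (m + n) 1 ∧
      survival b ρ (m + n) 1 ≤ harnack M p 3 * survival b ρ n 1 * survival b ρ m 1 := by
  rw [← iterate_survival]
  have hn := survival_unitMonotone b ρ n
  constructor
  · exact h.le_iterate_of_le_three hn UnitMonotone.one
      (fun q h1 _ => by simpa using hn.mono h1) m 1 le_rfl (by norm_num)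
  · exact h.iterate_le_of_le_three hn UnitMonotone.one
      (fun q h1 h3 => by simpa using h.survival_le_harnack n h1 h3) m 1 le_rfl (by norm_num)

/-- Up to a constant, the survival probability decays like a power of the limiting ratio. -/
lemma Regular.survival_one_bounds (h : Regular b M p ρ) {l : ℝ}
    (hl : Tendsto (fun n => survival b ρ (n + 1) 1 / survival b ρ n 1) atTop (𝓝 l)) (n : ℕ) :
    survival b ρ n 1 ≤ l ^ n ∧ l ^ n ≤ harnack M p 3 * survival b ρ n 1 := by
  have hn := h.tendsto_survival_ratio hl n
  constructor
  · refine ge_of_tendsto' hn fun m => ?_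
    rw [le_div_iff₀ (h.survival_pos m le_rfl)]
    exact (h.survival_add_bounds m n).1
  · refine le_of_tendsto' hn fun m => ?_
    rw [div_le_iff₀ (h.survival_pos m le_rfl)]
    exact (h.survival_add_bounds m n).2

/-- The survival probability, normalised by the powers of its decay rate, converges
exponentially fast. -/
theorem exists_survival_rate (M p : ℝ) :
    ∃ (g : ℝ) (K B : ℝ → ℝ), 0 < g ∧ g < 1 ∧ (∀ a, 0 < K a) ∧ (∀ a, 0 < p → 0 ≤ M → 0 < B a) ∧
      ∀ {b : ℕ} {ρ : ProbabilityMeasure ℝ}, Regular b M p ρ →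
        ∃ (l : ℝ) (ψ : ℝ → ℝ), p ≤ l ∧ l ≤ 1 ∧
          (∀ a θ, 1 ≤ θ → θ ≤ a → ∀ n : ℕ,
            |survival b ρ (n + 1) θ / survival b ρ n θ - l| ≤ K a * g ^ n) ∧
          (∀ n : ℕ, survival b ρ n 1 ≤ l ^ n ∧ l ^ n ≤ harnack M p 3 * survival b ρ n 1) ∧
          (∀ a θ, 1 ≤ θ → θ ≤ a → ∀ n : ℕ,
            |survival b ρ n θ * (l ^ n)⁻¹ - ψ θ| ≤ B a * g ^ n) := by
  obtain ⟨g, K, hg0, hg1, hK, H⟩ := exists_condMean_rate M p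
  have hg1' : 0 < 1 - g := by linarith
  refine ⟨g, K, fun a => harnack M p a * K a / p / (1 - g), hg0, hg1, hK, fun a hp hM => ?_, ?_⟩
  · have := two_le_harnack M p a
    have := hK a
    positivity
  intro b ρ h
  have hp := h.pos
  obtain ⟨l, hl01, hl⟩ := H h (h.survival_testFunction 1)
  simp only [condMean_survival_one] at hl
  have hgeo : ∀ C : ℝ, Tendsto (fun n : ℕ => C * g ^ n) atTop (𝓝 0) := fun C => by
    simpa using (tendsto_pow_atTop_nhds_zero_of_lt_one hg0.le hg1).const_mul C
  have hlim : Tendsto (fun n => survival b ρ (n + 1) 1 / survival b ρ n 1) atTop (𝓝 l) :=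
    tendsto_iff_norm_sub_tendsto_zero.2
      (squeeze_zero (fun _ => norm_nonneg _) (fun n => hl 1 1 le_rfl le_rfl n) (hgeo _))
  have hpl : p ≤ l := ge_of_tendsto' hlim fun n => by
    rw [← condMean_survival_one]
    simpa using h.le_condMean_survival 1 n le_rfl
  have hl0 : 0 < l := hp.trans_le hpl
  have hbounds := fun n => h.survival_one_bounds hlim n
  -- Each increment is the bounded normalised survival probability times the error of the ratio, so
  -- it is summable at the rate `g`.
  have hstep : ∀ a θ, 1 ≤ θ → θ ≤ a → ∀ n : ℕ,
      dist (survival b ρ n θ * (l ^ n)⁻¹) (survival b ρ (n + 1) θ * (l ^ (n + 1))⁻¹) ≤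
        harnack M p a * K a / p * g ^ n := by
    intro a θ h1 h2 n
    have hW := h.survival_pos n h1
    have hln : 0 < l ^ n := pow_pos hl0 n
    have hH : 0 < harnack M p a := by linarith [two_le_harnack M p a]
    rw [dist_comm, Real.dist_eq]
    have e1 : survival b ρ (n + 1) θ * (l ^ (n + 1))⁻¹ - survival b ρ n θ * (l ^ n)⁻¹ =
        survival b ρ n θ * (l ^ n)⁻¹ * l⁻¹ * (survival b ρ (n + 1) θ / survival b ρ n θ - l) := by
      rw [pow_succ]
      field_simp
    have e2 : survival b ρ n θ * (l ^ n)⁻¹ ≤ harnack M p a := by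
      rw [← div_eq_mul_inv, div_le_iff₀ hln]
      refine (h.survival_le_harnack n h1 h2).trans ?_
      exact mul_le_mul_of_nonneg_left (hbounds n).1 hH.le
    have e3 : l⁻¹ ≤ p⁻¹ := by gcongr
    rw [e1, abs_mul, abs_of_nonneg (by positivity)]
    calc _ ≤ harnack M p a * p⁻¹ * (K a * g ^ n) := by
          gcongr
          exact hl a θ h1 h2 n
      _ = _ := by ring
  have hex : ∀ θ, ∃ s, 1 ≤ θ → Tendsto (fun n => survival b ρ n θ * (l ^ n)⁻¹) atTop (𝓝 s) := by
    intro θ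
    by_cases h1 : 1 ≤ θ
    · obtain ⟨s, hs⟩ := cauchySeq_tendsto_of_complete
        (cauchySeq_of_le_geometric g _ hg1 (hstep θ θ h1 le_rfl))
      exact ⟨s, fun _ => hs⟩
    · exact ⟨0, fun h => absurd h h1⟩
  choose ψ hψ using hex
  refine ⟨l, ψ, hpl, hl01.2, hl, hbounds, fun a θ h1 h2 n => ?_⟩
  have := dist_le_of_le_geometric_of_tendsto g _ hg1 (hstep a θ h1 h2) (hψ θ h1) n
  rw [Real.dist_eq] at this
  refine this.trans (le_of_eq ?_)
  ring

end Normalized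

/-! ### From the i.i.d. sequence to the operator. -/

section SequenceSpace

variable {b : ℕ} {M p : ℝ} {ρ : ProbabilityMeasure ℝ}

instance (ρ : ProbabilityMeasure ℝ) : IsProbabilityMeasure (seqLaw ρ) := by
  unfold seqLaw; infer_instance

lemma measurable_update (i : ℕ) :
    Measurable (fun z : ℝ × (ℕ → ℝ) => Function.update z.2 i z.1) := by
  refine measurable_pi_lambda _ fun j => ?_
  by_cases hj : j = i
  · subst hj; simpa using measurable_fst
  · simp only [Function.update_of_ne hj]
    exact (measurable_pi_apply j).comp measurable_snd

lemma measurable_cons : Measurable (fun (z : ℝ × (ℕ → ℝ)) (n : ℕ) =>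
    Nat.casesOn (motive := fun _ => ℝ) n z.1 z.2) := by
  refine measurable_pi_lambda _ fun j => ?_
  cases j with
  | zero => exact measurable_fst
  | succ j => exact (measurable_pi_apply j).comp measurable_snd

/-- Resampling one coordinate does not change the law of an i.i.d. sequence. -/
lemma map_update_seqLaw (ρ : ProbabilityMeasure ℝ) (i : ℕ) :
    ((ρ : Measure ℝ).prod (seqLaw ρ)).map (fun z => Function.update z.2 i z.1) = seqLaw ρ := by
  refine Measure.eq_infinitePi _ fun s t ht => ?_
  rw [Measure.map_apply (measurable_update i) (.pi (Finset.countable_toSet s) fun j _ => ht j)]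
  by_cases hi : i ∈ s
  · have : (fun z : ℝ × (ℕ → ℝ) => Function.update z.2 i z.1) ⁻¹' (Set.pi s t) =
        t i ×ˢ Set.pi (s.erase i : Finset ℕ) t := by
      ext z
      simp only [Set.mem_preimage, Set.mem_pi, Finset.mem_coe, Set.mem_prod, Finset.mem_erase]
      constructor
      · intro h
        refine ⟨by simpa using h i hi, fun j hj => ?_⟩
        simpa [hj.1] using h j hj.2
      · rintro ⟨h1, h2⟩ j hj
        by_cases hji : j = i
        · subst hji; simpa using h1
        · simpa [hji] using h2 j ⟨hji, hj⟩
    rw [this, Measure.prod_prod, seqLaw, Measure.infinitePi_pi _ fun j _ => ht j]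
    exact Finset.mul_prod_erase s (fun j => (ρ : Measure ℝ) (t j)) hi
  · have : (fun z : ℝ × (ℕ → ℝ) => Function.update z.2 i z.1) ⁻¹' (Set.pi s t) =
        Set.univ ×ˢ Set.pi s t := by
      ext z
      simp only [Set.mem_preimage, Set.mem_pi, Finset.mem_coe, Set.mem_prod, Set.mem_univ,
        true_and]
      refine forall₂_congr fun j hj => ?_
      have hji : j ≠ i := fun h => hi (h ▸ hj)
      simp [hji]
    rw [this, Measure.prod_prod, seqLaw, Measure.infinitePi_pi _ fun j _ => ht j]
    simp

/-- Prepending an independent coordinate does not change the law of an i.i.d. sequence. -/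
lemma map_cons_seqLaw (ρ : ProbabilityMeasure ℝ) :
    ((ρ : Measure ℝ).prod (seqLaw ρ)).map
      (fun z (n : ℕ) => Nat.casesOn (motive := fun _ => ℝ) n z.1 z.2) = seqLaw ρ := by
  refine Measure.eq_infinitePi _ fun s t ht => ?_
  have key : ∀ u : Finset ℕ, ∀ v : ℕ → Set ℝ, (∀ j, MeasurableSet (v j)) →
      seqLaw ρ (Set.pi u v) = ∏ j ∈ u, (ρ : Measure ℝ) (v j) := fun u v hv =>
    Measure.infinitePi_pi _ fun j _ => hv j
  rw [Measure.map_apply measurable_cons (.pi (Finset.countable_toSet s) fun j _ => ht j)]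
  set u : Finset ℕ := (s.erase 0).image Nat.pred with hu
  have hmem : ∀ j, j ∈ u ↔ j + 1 ∈ s := by
    intro j
    simp only [hu, Finset.mem_image, Finset.mem_erase]
    constructor
    · rintro ⟨i, ⟨hi0, his⟩, rfl⟩
      rwa [Nat.pred_eq_sub_one, Nat.sub_add_cancel (Nat.one_le_iff_ne_zero.2 hi0)]
    · intro h
      exact ⟨j + 1, ⟨by omega, h⟩, rfl⟩
  have hset : (fun (z : ℝ × (ℕ → ℝ)) (n : ℕ) =>
      Nat.casesOn (motive := fun _ => ℝ) n z.1 z.2) ⁻¹' (Set.pi s t) =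
        (if 0 ∈ s then t 0 else Set.univ) ×ˢ Set.pi u (fun j => t (j + 1)) := by
    ext z
    simp only [Set.mem_preimage, Set.mem_pi, Finset.mem_coe, Set.mem_prod, hmem]
    constructor
    · intro h
      refine ⟨?_, fun j hj => h (j + 1) hj⟩
      split_ifs with h0
      · exact h 0 h0
      · trivial
    · rintro ⟨h1, h2⟩ j hj
      cases j with
      | zero => simpa [hj] using h1
      | succ j => exact h2 j hj
  have hprod : ∏ j ∈ u, (ρ : Measure ℝ) (t (j + 1)) = ∏ j ∈ s.erase 0, (ρ : Measure ℝ) (t j) := by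
    refine Finset.prod_nbij' Nat.succ Nat.pred ?_ ?_ ?_ ?_ ?_
    · intro j hj
      exact Finset.mem_erase.2 ⟨by simp, (hmem j).1 hj⟩
    · intro j hj
      exact Finset.mem_image_of_mem _ hj
    · intro j _; rfl
    · intro j hj
      exact Nat.succ_pred_eq_of_ne_zero (Finset.mem_erase.1 hj).1
    · intro j _; rfl
  rw [hset, Measure.prod_prod, key u _ fun j => ht (j + 1), hprod]
  split_ifs with h0
  · exact Finset.mul_prod_erase s (fun j => (ρ : Measure ℝ) (t j)) h0
  · rw [measure_univ, one_mul, Finset.erase_eq_of_notMem h0]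

lemma measureReal_prod_eq_integral (ρ : ProbabilityMeasure ℝ) {E : Set (ℝ × (ℕ → ℝ))}
    (hE : MeasurableSet E) :
    ((ρ : Measure ℝ).prod (seqLaw ρ)).real E =
      ∫ x, (seqLaw ρ).real (Prod.mk x ⁻¹' E) ∂(ρ : Measure ℝ) := by
  rw [measureReal_def, Measure.prod_apply hE, integral_eq_lintegral_of_nonneg_ae]
  · congr 1
    refine lintegral_congr fun x => ?_
    rw [measureReal_def, ENNReal.ofReal_toReal (measure_ne_top _ _)]
  · exact ae_of_all _ fun x => measureReal_nonneg
  · exact (measurable_measure_prodMk_left hE).ennreal_toReal.aestronglyMeasurable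

lemma seqLaw_real_eq_integral_update (ρ : ProbabilityMeasure ℝ) (i : ℕ) {E : Set (ℕ → ℝ)}
    (hE : MeasurableSet E) :
    (seqLaw ρ).real E =
      ∫ x, (seqLaw ρ).real {y | Function.update y i x ∈ E} ∂(ρ : Measure ℝ) := by
  conv_lhs => rw [← map_update_seqLaw ρ i]
  rw [map_measureReal_apply (measurable_update i) hE,
    measureReal_prod_eq_integral ρ (measurable_update i hE)]
  rfl

lemma seqLaw_real_eq_integral_cons (ρ : ProbabilityMeasure ℝ) {E : Set (ℕ → ℝ)}
    (hE : MeasurableSet E) :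
    (seqLaw ρ).real E = ∫ x, (seqLaw ρ).real
      {y | (fun n : ℕ => Nat.casesOn (motive := fun _ => ℝ) n x y) ∈ E} ∂(ρ : Measure ℝ) := by
  conv_lhs => rw [← map_cons_seqLaw ρ]
  rw [map_measureReal_apply measurable_cons hE,
    measureReal_prod_eq_integral ρ (measurable_cons hE)]
  rfl

lemma measurable_Q (b : ℕ) (θ : ℝ) (n : ℕ) : Measurable fun x => Q b θ x n := by
  induction n with
  | zero => exact measurable_const
  | succ n ih => exact (measurable_pi_apply n).add (ih.div_const _)

lemma Q_cons (b : ℕ) (θ x : ℝ) (y : ℕ → ℝ) (n : ℕ) :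
    Q b θ (fun n : ℕ => Nat.casesOn (motive := fun _ => ℝ) n x y) (n + 1) =
      Q b (x + θ / b) y n := by
  induction n with
  | zero => rfl
  | succ n ih => rw [Q, ih]; rfl

lemma measurableSet_survive (b : ℕ) (θ : ℝ) (n : ℕ) :
    MeasurableSet {x : ℕ → ℝ | ∀ k ≤ n, 1 ≤ Q b θ x k} := by
  have : {x : ℕ → ℝ | ∀ k ≤ n, 1 ≤ Q b θ x k} =
      ⋂ k, ⋂ _ : k ≤ n, {x : ℕ → ℝ | 1 ≤ Q b θ x k} := by ext; simp
  rw [this]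
  exact .iInter fun k => .iInter fun _ => measurableSet_le measurable_const (measurable_Q b θ k)

/-- Integrate over the first innovation: the shifted sequence is again i.i.d. and drives the chain
from `x + θ / b`. The indicator accounts for the constraint at time 0, which `survival` omits. -/
lemma Z_eq_indicator (b : ℕ) (ρ : ProbabilityMeasure ℝ) (n : ℕ) (θ : ℝ) :
    Z b ρ n θ = (Set.Ici (1 : ℝ)).indicator (survival b ρ n) θ := by
  induction n generalizing θ with
  | zero =>
    by_cases hθ : 1 ≤ θ
    · simp [Z, Q, hθ, survival_zero]
    · simp [Z, Q, hθ]
  | succ n ih =>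
    by_cases hθ : 1 ≤ θ
    · have hθ' : θ ∈ Set.Ici (1 : ℝ) := hθ
      rw [Set.indicator_of_mem hθ', survival_succ, step, Z,
        seqLaw_real_eq_integral_cons ρ (measurableSet_survive b θ (n + 1))]
      refine integral_congr_ae (ae_of_all _ fun x => ?_)
      simp only
      rw [← ih, Z]
      congr 1
      ext y
      simp only [Set.mem_ofPred_eq]
      constructor
      · intro hk k hkn
        rw [← Q_cons]
        exact hk (k + 1) (by omega)
      · intro hk k hkn
        cases k with
        | zero => exact hθ
        | succ k => rw [Q_cons]; exact hk k (by omega)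
    · have hθ' : θ ∉ Set.Ici (1 : ℝ) := hθ
      rw [Set.indicator_of_notMem hθ', Z]
      have : {x : ℕ → ℝ | ∀ k ≤ n + 1, 1 ≤ Q b θ x k} = ∅ := by
        ext x
        simp only [Set.mem_ofPred_eq, Set.mem_empty_iff_false, iff_false]
        intro hk
        exact hθ (hk 0 (Nat.zero_le _))
      rw [this, measureReal_empty]

lemma Z_eq_survival (b : ℕ) (ρ : ProbabilityMeasure ℝ) (n : ℕ) {θ : ℝ} (hθ : 1 ≤ θ) :
    Z b ρ n θ = survival b ρ n θ := by
  rw [Z_eq_indicator, Set.indicator_of_mem (show θ ∈ Set.Ici (1 : ℝ) from hθ)]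

lemma Z_eq_zero (b : ℕ) (ρ : ProbabilityMeasure ℝ) (n : ℕ) {θ : ℝ} (hθ : θ < 1) :
    Z b ρ n θ = 0 := by
  rw [Z_eq_indicator, Set.indicator_of_notMem (by simpa using hθ)]

end SequenceSpace

/-! ### Rates and regularity of `z` and `psi`. -/

section Rates

variable {b : ℕ} {M p : ℝ} {ρ : ProbabilityMeasure ℝ}

lemma tendsto_rpow_one_div_of_bounds {a : ℕ → ℝ} {l c C : ℝ} (hl : 0 < l) (hc : 0 < c)
    (h1 : ∀ n, c * l ^ n ≤ a n) (h2 : ∀ n, a n ≤ C * l ^ n) :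
    Tendsto (fun n : ℕ => a n ^ (1 / (n : ℝ))) atTop (𝓝 l) := by
  have hC : 0 < C := hc.trans_le (by simpa using (h1 0).trans (h2 0))
  have hroot : ∀ d : ℝ, 0 < d →
      Tendsto (fun n : ℕ => (d * l ^ n) ^ (1 / (n : ℝ))) atTop (𝓝 l) := by
    intro d hd
    have e1 : Tendsto (fun n : ℕ => d ^ (1 / (n : ℝ)) * l) atTop (𝓝 (d ^ (0 : ℝ) * l)) :=
      (tendsto_const_nhds.rpow tendsto_one_div_atTop_nhds_zero_nat (Or.inl hd.ne')).mul_const l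
    rw [Real.rpow_zero, one_mul] at e1
    refine e1.congr' ((eventually_gt_atTop 0).mono fun n hn => ?_)
    have hn' : (n : ℝ) ≠ 0 := by exact_mod_cast hn.ne'
    change _ = (d * l ^ n) ^ (1 / (n : ℝ))
    rw [Real.mul_rpow hd.le (pow_pos hl n).le, ← Real.rpow_natCast l n, ← Real.rpow_mul hl.le,
      mul_one_div_cancel hn', Real.rpow_one]
  refine tendsto_of_tendsto_of_tendsto_of_le_of_le (hroot c hc) (hroot C hC) ?_ ?_
  · intro n
    have := pow_pos hl n
    exact Real.rpow_le_rpow (by positivity) (h1 n) (by positivity)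
  · intro n
    have := pow_pos hl n
    exact Real.rpow_le_rpow ((by positivity : 0 ≤ c * l ^ n).trans (h1 n)) (h2 n) (by positivity)

/-- Existence of `z` and `psi`, with exponential rates of convergence depending only on the
parameters of regularity. -/
theorem exists_rate_bounds (M p : ℝ) :
    ∃ (ζ : ℝ) (K A : ℝ → ℝ), 0 < ζ ∧ (∀ a, 0 < p → 0 ≤ M → 0 < A a) ∧
      ∀ {b : ℕ} {ρ : ProbabilityMeasure ℝ}, Regular b M p ρ →
        p ≤ z b ρ ∧
        (∀ θ, 1 ≤ θ → Tendsto (fun n : ℕ => Z b ρ n θ ^ (1 / (n : ℝ))) atTop (𝓝 (z b ρ))) ∧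
        (∀ a θ, 1 ≤ θ → θ ≤ a → ∀ n : ℕ,
          |survival b ρ (n + 1) θ / survival b ρ n θ - z b ρ| ≤
            K a * Real.exp (-(ζ * (n : ℝ)))) ∧
        (∀ a θ, θ ≤ a → ∀ n : ℕ,
          |Z b ρ n θ * (z b ρ ^ n)⁻¹ - psi b ρ θ| ≤ A a * Real.exp (-(ζ * (n : ℝ)))) ∧
        (∀ θ, 1 ≤ θ → 0 < psi b ρ θ) ∧ ∀ θ, θ < 1 → psi b ρ θ = 0 := by
  obtain ⟨g, K, B, hg0, hg1, hK, hB, H⟩ := exists_survival_rate M p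
  have hexp : ∀ n : ℕ, Real.exp (-(-Real.log g * (n : ℝ))) = g ^ n := by
    intro n
    rw [neg_mul, neg_neg, mul_comm, Real.exp_nat_mul, Real.exp_log hg0]
  refine ⟨-Real.log g, K, B, by linarith [Real.log_neg hg0 hg1], hB, ?_⟩
  intro b ρ h
  simp only [hexp]
  obtain ⟨l, ψ, hpl, hl1, hr, hbd, hψ⟩ := H h
  have hp := h.pos
  have hM := h.half_le
  have hl0 : 0 < l := hp.trans_le hpl
  have hH := two_le_harnack M p 3
  have hroot : ∀ θ, 1 ≤ θ → Tendsto (fun n : ℕ => Z b ρ n θ ^ (1 / (n : ℝ))) atTop (𝓝 l) := by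
    intro θ hθ
    simp only [Z_eq_survival b ρ _ hθ]
    refine tendsto_rpow_one_div_of_bounds (c := (harnack M p 3)⁻¹) (C := harnack M p θ) hl0
      (inv_pos.2 (by linarith)) (fun n => ?_) (fun n => ?_)
    · rw [inv_mul_le_iff₀ (by linarith)]
      refine (hbd n).2.trans (mul_le_mul_of_nonneg_left ?_ (by linarith))
      exact (survival_unitMonotone b ρ n).mono hθ
    · refine (h.survival_le_harnack n hθ le_rfl).trans (mul_le_mul_of_nonneg_left (hbd n).1 ?_)
      linarith [two_le_harnack M p θ]
  have hz : z b ρ = l := (hroot 1 le_rfl).limUnder_eq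
  rw [hz]
  have hlim : ∀ θ, 1 ≤ θ →
      Tendsto (fun n => Z b ρ n θ * (l ^ n)⁻¹) atTop (𝓝 (ψ θ)) := by
    intro θ hθ
    refine tendsto_iff_norm_sub_tendsto_zero.2
      (squeeze_zero (fun _ => norm_nonneg _) (g := fun n => B θ * g ^ n) (fun n => ?_) ?_)
    · rw [Z_eq_survival b ρ _ hθ]
      exact hψ θ θ hθ le_rfl n
    · simpa using (tendsto_pow_atTop_nhds_zero_of_lt_one hg0.le hg1).const_mul (B θ)
  have hpsi : ∀ θ, 1 ≤ θ → psi b ρ θ = ψ θ := by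
    intro θ hθ
    unfold psi
    rw [hz]
    exact (hlim θ hθ).limUnder_eq
  have hpsi0 : ∀ θ, θ < 1 → psi b ρ θ = 0 := by
    intro θ hθ
    unfold psi
    simp only [Z_eq_zero b ρ _ hθ, zero_mul]
    exact tendsto_const_nhds.limUnder_eq
  refine ⟨hpl, hroot, hr, ?_, ?_, hpsi0⟩
  · intro a θ ha n
    rcases le_or_gt 1 θ with hθ | hθ
    · rw [hpsi θ hθ, Z_eq_survival b ρ _ hθ]
      exact hψ a θ hθ ha n
    · rw [hpsi0 θ hθ, Z_eq_zero b ρ _ hθ, zero_mul, sub_zero, abs_zero]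
      have := hB a hp (by linarith)
      positivity
  · intro θ hθ
    rw [hpsi θ hθ]
    -- Positivity needs a bound uniform in `n`; approximate multiplicativity supplies it.
    have : (harnack M p 3)⁻¹ ≤ ψ θ := ge_of_tendsto' (hlim θ hθ) fun n => by
      have hln := pow_pos hl0 n
      rw [Z_eq_survival b ρ _ hθ, ← div_eq_mul_inv, le_div_iff₀ hln, inv_mul_le_iff₀ (by linarith)]
      refine (hbd n).2.trans (mul_le_mul_of_nonneg_left ?_ (by linarith))
      exact (survival_unitMonotone b ρ n).mono hθ
    exact (inv_pos.2 (by linarith)).trans_le this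

lemma tendsto_mul_exp_neg {ζ : ℝ} (hζ : 0 < ζ) (C : ℝ) :
    Tendsto (fun n : ℕ => C * Real.exp (-(ζ * (n : ℝ)))) atTop (𝓝 0) := by
  have e1 : Tendsto (fun n : ℕ => ζ * (n : ℝ)) atTop atTop :=
    tendsto_natCast_atTop_atTop.const_mul_atTop hζ
  simpa using (Real.tendsto_exp_neg_atTop_nhds_zero.comp e1).const_mul C

lemma Regular.z_pos (h : Regular b M p ρ) : 0 < z b ρ := by
  obtain ⟨ζ, K, A, hζ, hA, H⟩ := exists_rate_bounds M p
  exact h.pos.trans_le (H h).1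

lemma Regular.tendsto_psi (h : Regular b M p ρ) (θ : ℝ) :
    Tendsto (fun n : ℕ => Z b ρ n θ * (z b ρ ^ n)⁻¹) atTop (𝓝 (psi b ρ θ)) := by
  obtain ⟨ζ, K, A, hζ, hA, H⟩ := exists_rate_bounds M p
  obtain ⟨-, -, -, h4, -, -⟩ := H h
  exact tendsto_iff_norm_sub_tendsto_zero.2
    (squeeze_zero (fun _ => norm_nonneg _) (fun n => h4 θ θ le_rfl n) (tendsto_mul_exp_neg hζ _))

lemma Regular.tendsto_survival_ratio_z (h : Regular b M p ρ) {θ : ℝ} (hθ : 1 ≤ θ) :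
    Tendsto (fun n : ℕ => survival b ρ (n + 1) θ / survival b ρ n θ) atTop (𝓝 (z b ρ)) := by
  obtain ⟨ζ, K, A, hζ, hA, H⟩ := exists_rate_bounds M p
  obtain ⟨-, -, h3, -⟩ := H h
  exact tendsto_iff_norm_sub_tendsto_zero.2
    (squeeze_zero (fun _ => norm_nonneg _) (fun n => h3 θ θ hθ le_rfl n)
      (tendsto_mul_exp_neg hζ _))

lemma Regular.psi_monotoneOn (h : Regular b M p ρ) : MonotoneOn (psi b ρ) (Set.Ici 1) := by
  intro θ' h1 θ h1' h2
  refine le_of_tendsto_of_tendsto' (h.tendsto_psi θ') (h.tendsto_psi θ) fun n => ?_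
  have := pow_pos h.z_pos n
  rw [Z_eq_survival b ρ n h1, Z_eq_survival b ρ n h1']
  exact mul_le_mul_of_nonneg_right ((survival_unitMonotone b ρ n).mono h2) (by positivity)

lemma Regular.psi_sub_le (h : Regular b M p ρ) {θ' θ : ℝ} (h1 : 1 ≤ θ') (h2 : θ' ≤ θ) :
    psi b ρ θ - psi b ρ θ' ≤ 4 * M / p * (θ - θ') * psi b ρ θ := by
  refine le_of_tendsto_of_tendsto' ((h.tendsto_psi θ).sub (h.tendsto_psi θ'))
    ((h.tendsto_psi θ).const_mul _) fun n => ?_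
  have := pow_pos h.z_pos n
  rw [Z_eq_survival b ρ n h1, Z_eq_survival b ρ n (h1.trans h2), ← sub_mul, ← mul_assoc]
  exact mul_le_mul_of_nonneg_right (h.survival_sub_le n h1 h2) (by positivity)

lemma Regular.abs_psi_sub_le (h : Regular b M p ρ) {θ₀ θ θ' : ℝ} (h1 : θ ∈ Set.Icc 1 θ₀)
    (h1' : θ' ∈ Set.Icc 1 θ₀) :
    |psi b ρ θ - psi b ρ θ'| ≤ 4 * M / p * psi b ρ θ₀ * |θ - θ'| := by
  wlog hle : θ' ≤ θ generalizing θ θ'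
  · rw [abs_sub_comm, abs_sub_comm θ]
    exact this h1' h1 (le_of_not_ge hle)
  have e1 := h.psi_monotoneOn h1'.1 h1.1 hle
  have e2 := h.psi_monotoneOn h1.1 (h1.1.trans h1.2 : (1 : ℝ) ≤ θ₀) h1.2
  have hM := h.half_le
  have hp := h.pos
  rw [abs_of_nonneg (by linarith), abs_of_nonneg (by linarith)]
  refine (h.psi_sub_le h1'.1 hle).trans ?_
  have e3 : 0 ≤ θ - θ' := by linarith
  calc _ ≤ 4 * M / p * (θ - θ') * psi b ρ θ₀ := by gcongr
    _ = _ := by ring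

end Rates

/-! ### Uniformity of the parameters on convex hulls. -/

section Hull

variable {b : ℕ} {M p : ℝ} {ρ : ProbabilityMeasure ℝ}

lemma Regular.mono (h : Regular b M p ρ) {M' p' : ℝ} (hM : M ≤ M') (hp' : 0 < p') (hp : p' ≤ p) :
    Regular b M' p' ρ where
  two_le := h.two_le
  pos := hp'
  ae_mem := h.ae_mem
  Ico_le := fun a c hac => (h.Ico_le a c hac).trans (by gcongr)
  le_mass := hp.trans h.le_mass

/-- A single integer encodes both parameters, so that constants are indexed by ℕ and uniform bounds
reduce to finitely many values. -/
lemma exists_regular (hb : 2 ≤ b) (hρ : ρ ∈ BoundedDensity b) :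
    ∃ k : ℕ, Regular b k (1 / ((k : ℝ) + 1)) ρ := by
  obtain ⟨⟨φ, hφm, hφ, M, hM⟩, hpos⟩ := hρ
  have hp : 0 < (ρ : Measure ℝ).real (Set.Icc (1 - 1 / (b : ℝ)) 1) :=
    ENNReal.toReal_pos hpos.ne' (measure_ne_top _ _)
  have hreg : Regular b M ((ρ : Measure ℝ).real (Set.Icc (1 - 1 / (b : ℝ)) 1)) ρ := by
    refine ⟨hb, hp, ?_, ?_, le_rfl⟩
    · rw [hφ]
      exact (withDensity_absolutelyContinuous _ _).ae_le (ae_restrict_mem measurableSet_Icc)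
    · intro a c hac
      have : (ρ : Measure ℝ) (Set.Ico a c) ≤ ENNReal.ofReal (M * (c - a)) := by
        rw [hφ, withDensity_apply _ measurableSet_Ico]
        calc _ ≤ ∫⁻ _ in Set.Ico a c, (M : ℝ≥0∞) ∂(volume.restrict (Set.Icc (0 : ℝ) 1)) :=
              lintegral_mono_ae (ae_restrict_of_ae hM)
          _ = M * (volume.restrict (Set.Icc (0 : ℝ) 1)) (Set.Ico a c) := by
              rw [setLIntegral_const]
          _ ≤ M * volume (Set.Ico a c) := by
              gcongr
              exact Measure.restrict_le_self
          _ = _ := by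
              rw [Real.volume_Ico, ENNReal.ofReal_mul (NNReal.coe_nonneg M), ENNReal.ofReal_coe_nnreal]
      have h2 : 0 ≤ (M : ℝ) * (c - a) := mul_nonneg M.2 (by linarith)
      exact ENNReal.toReal_le_of_le_ofReal h2 this
  obtain ⟨k, hk⟩ := exists_nat_ge
    (max (M : ℝ) (1 / (ρ : Measure ℝ).real (Set.Icc (1 - 1 / (b : ℝ)) 1)))
  refine ⟨k, hreg.mono ((le_max_left _ _).trans hk) (by positivity) ?_⟩
  have h3 := (le_max_right _ _).trans hk
  rw [div_le_iff₀ hp] at h3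
  rw [div_le_iff₀ (by positivity)]
  linarith

lemma regular_mono {k k' : ℕ} (h : Regular b k (1 / ((k : ℝ) + 1)) ρ) (hk : k ≤ k') :
    Regular b k' (1 / ((k' : ℝ) + 1)) ρ := by
  have : (k : ℝ) ≤ k' := by exact_mod_cast hk
  exact h.mono this (by positivity) (by gcongr)

lemma hull_real {m : ℕ} {σ : Fin m → ProbabilityMeasure ℝ} {w : Fin m → ℝ≥0}
    (hw : (ρ : Measure ℝ) = ∑ i, w i • (σ i : Measure ℝ)) (s : Set ℝ) :
    (ρ : Measure ℝ).real s = ∑ i, (w i : ℝ) * (σ i : Measure ℝ).real s := by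
  rw [measureReal_def, hw, Measure.finsetSum_apply, ENNReal.toReal_sum]
  · refine Finset.sum_congr rfl fun i _ => ?_
    rw [Measure.smul_apply, ENNReal.smul_def, smul_eq_mul, ENNReal.toReal_mul]
    rfl
  · intro i _
    exact measure_ne_top _ _

/-- Each condition is linear in the measure, with bounds common to all `σ i`. -/
lemma regular_of_mem_hull (hb : 2 ≤ b) (hp : 0 < p) {m : ℕ} {σ : Fin m → ProbabilityMeasure ℝ}
    (hσ : ∀ i, Regular b M p (σ i)) (hρ : ρ ∈ hull σ) : Regular b M p ρ := by
  obtain ⟨w, hw1, hw⟩ := hρ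
  have hw1' : ∑ i, (w i : ℝ) = 1 := by exact_mod_cast hw1
  refine ⟨hb, hp, ?_, ?_, ?_⟩
  · rw [ae_iff, ← measureReal_eq_zero_iff, hull_real hw]
    refine Finset.sum_eq_zero fun i _ => ?_
    have := (hσ i).ae_mem
    rw [ae_iff, ← measureReal_eq_zero_iff] at this
    rw [this, mul_zero]
  · intro a c hac
    rw [hull_real hw]
    calc _ ≤ ∑ i, (w i : ℝ) * (M * (c - a)) :=
          Finset.sum_le_sum fun i _ => mul_le_mul_of_nonneg_left ((hσ i).Ico_le a c hac) (w i).2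
      _ = _ := by rw [← Finset.sum_mul, hw1', one_mul]
  · rw [hull_real hw]
    calc p = ∑ i, (w i : ℝ) * p := by rw [← Finset.sum_mul, hw1', one_mul]
      _ ≤ _ := Finset.sum_le_sum fun i _ => mul_le_mul_of_nonneg_left (hσ i).le_mass (w i).2

lemma mix_mem_hull (ρ ρ' : ProbabilityMeasure ℝ) (α : Set.Icc (0 : ℝ) 1) :
    mix ρ ρ' α ∈ hull ![ρ, ρ'] := by
  refine ⟨![(1 - (α : ℝ)).toNNReal, (α : ℝ).toNNReal], ?_, ?_⟩
  · simp only [Fin.sum_univ_two, Matrix.cons_val_zero, Matrix.cons_val_one]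
    rw [← Real.toNNReal_add (by linarith [α.2.2]) α.2.1]
    simp
  · simp only [Fin.sum_univ_two, Matrix.cons_val_zero, Matrix.cons_val_one]
    rfl

end Hull

/-! ### Continuity along convex interpolations. -/

section Continuity

variable {b : ℕ} {ρ ρ' : ProbabilityMeasure ℝ}

lemma step_mix {f : ℝ → ℝ} (hf : UnitMonotone f) (α : Set.Icc (0 : ℝ) 1) (θ : ℝ) :
    step b (mix ρ ρ' α) f θ = (1 - (α : ℝ)) * step b ρ f θ + (α : ℝ) * step b ρ' f θ := by
  have e : ((mix ρ ρ' α : ProbabilityMeasure ℝ) : Measure ℝ) =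
    ENNReal.ofReal (1 - (α : ℝ)) • (ρ : Measure ℝ) + ENNReal.ofReal (α : ℝ) • (ρ' : Measure ℝ) :=
    rfl
  rw [step, e, integral_add_measure ((hf.integrable _).smul_measure ENNReal.ofReal_ne_top)
    ((hf.integrable _).smul_measure ENNReal.ofReal_ne_top), integral_smul_measure,
    integral_smul_measure, ENNReal.toReal_ofReal (by linarith [α.2.2]),
    ENNReal.toReal_ofReal α.2.1]
  rfl

lemma continuous_survival_mix (n : ℕ) (θ : ℝ) :
    Continuous fun α : Set.Icc (0 : ℝ) 1 => survival b (mix ρ ρ' α) n θ := by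
  induction n generalizing θ with
  | zero => exact continuous_const
  | succ n ih =>
    have hstep : ∀ σ : ProbabilityMeasure ℝ,
        Continuous fun α : Set.Icc (0 : ℝ) 1 => step b σ (survival b (mix ρ ρ' α) n) θ := by
      intro σ
      refine continuous_of_dominated (bound := fun _ => 1) (fun α => ?_) (fun α => ?_)
        (integrable_const _) (ae_of_all _ fun x => ?_)
      · exact ((survival_unitMonotone b _ n).integrable (ρ := σ) _).aestronglyMeasurable
      · refine ae_of_all _ fun x => ?_
        have := (survival_unitMonotone b (mix ρ ρ' α) n).indicator
        rw [Real.norm_eq_abs, abs_of_nonneg (this.nonneg _)]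
        exact this.le_one _
      · by_cases hx : x + θ / b ∈ Set.Ici (1 : ℝ)
        · simpa only [Set.indicator_of_mem hx] using ih _
        · simp only [Set.indicator_of_notMem hx]
          exact continuous_const
    simp only [survival_succ, step_mix (survival_unitMonotone b _ n)]
    have := hstep ρ
    have := hstep ρ'
    fun_prop

lemma continuous_of_uniform_rate {X : Type*} [TopologicalSpace X] {F : ℕ → X → ℝ} {f : X → ℝ}
    {u : ℕ → ℝ} (hu : Tendsto u atTop (𝓝 0)) (hF : ∀ n, Continuous (F n))
    (h : ∀ n x, |F n x - f x| ≤ u n) : Continuous f := by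
  have : TendstoUniformly F f atTop := by
    rw [Metric.tendstoUniformly_iff]
    intro ε hε
    filter_upwards [hu.eventually_lt_const hε] with n hn x
    rw [dist_comm, Real.dist_eq]
    exact (h n x).trans_lt hn
  exact this.continuous (Frequently.of_forall hF)

lemma continuous_psi_mix (hb : 2 ≤ b) (hρ : ρ ∈ BoundedDensity b) (hρ' : ρ' ∈ BoundedDensity b)
    (θ : ℝ) : Continuous fun α : Set.Icc (0 : ℝ) 1 => psi b (mix ρ ρ' α) θ := by
  obtain ⟨k, hk⟩ := exists_regular hb hρ
  obtain ⟨k', hk'⟩ := exists_regular hb hρ'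
  set m := max k k'
  have hreg : ∀ α, Regular b m (1 / ((m : ℝ) + 1)) (mix ρ ρ' α) := fun α => by
    refine regular_of_mem_hull hb (by positivity) (fun i => ?_) (mix_mem_hull ρ ρ' α)
    fin_cases i
    · exact regular_mono hk (le_max_left _ _)
    · exact regular_mono hk' (le_max_right _ _)
  obtain ⟨ζ, K, A, hζ, -, H⟩ := exists_rate_bounds (m : ℝ) (1 / ((m : ℝ) + 1))
  rcases lt_or_ge θ 1 with hθ | hθ
  · have : ∀ α, psi b (mix ρ ρ' α) θ = 0 := fun α => (H (hreg α)).2.2.2.2.2 θ hθ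
    simp only [this]
    exact continuous_const
  -- The rates are the same for all α, so `z` is a uniform limit of continuous ratios; the same
  -- argument then gives `psi`.
  · have hz : Continuous fun α : Set.Icc (0 : ℝ) 1 => z b (mix ρ ρ' α) := by
      refine continuous_of_uniform_rate (tendsto_mul_exp_neg hζ (K 1))
        (F := fun n α => survival b (mix ρ ρ' α) (n + 1) 1 / survival b (mix ρ ρ' α) n 1)
        (fun n => ?_) (fun n α => (H (hreg α)).2.2.1 1 1 le_rfl le_rfl n)
      exact (continuous_survival_mix _ _).div (continuous_survival_mix _ _)
        fun α => ((hreg α).survival_pos n le_rfl).ne'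
    refine continuous_of_uniform_rate (tendsto_mul_exp_neg hζ (A θ))
      (F := fun n α => Z b (mix ρ ρ' α) n θ * (z b (mix ρ ρ' α) ^ n)⁻¹)
      (fun n => ?_) (fun n α => (H (hreg α)).2.2.2.1 θ θ le_rfl n)
    simp only [Z_eq_survival b _ n hθ]
    exact (continuous_survival_mix _ _).mul
      ((hz.pow n).inv₀ fun α => (pow_pos (hreg α).z_pos n).ne')

end Continuity

/-! ### The reversed chain and its conditional laws. -/

section Reversed

variable {b : ℕ} {M p : ℝ} {ρ : ProbabilityMeasure ℝ}

/-- The event that the reversed chain stays above `1` at the times `m, …, n`. -/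
def tailEvent (b n m : ℕ) (θ : ℝ) : Set (ℕ → ℝ) :=
  {y | ∀ l ∈ Finset.Icc m n, 1 ≤ revQ b θ n l y}

lemma measurable_revQ (b : ℕ) (θ : ℝ) (n l : ℕ) : Measurable (revQ b θ n l) := by
  unfold revQ
  fun_prop

lemma measurableSet_tailEvent (b n m : ℕ) (θ : ℝ) : MeasurableSet (tailEvent b n m θ) := by
  have : tailEvent b n m θ = ⋂ l ∈ Finset.Icc m n, {y | 1 ≤ revQ b θ n l y} := by
    ext; simp [tailEvent]
  rw [this]
  exact Finset.measurableSet_biInter _ fun l _ =>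
    measurableSet_le measurable_const (measurable_revQ b θ n l)

lemma revQ_mono (b n l : ℕ) (y : ℕ → ℝ) {θ' θ : ℝ} (h : θ' ≤ θ) :
    revQ b θ' n l y ≤ revQ b θ n l y := by
  unfold revQ
  gcongr

lemma tailEvent_mono (b n m : ℕ) {θ' θ : ℝ} (h : θ' ≤ θ) :
    tailEvent b n m θ' ⊆ tailEvent b n m θ :=
  fun y hy l hl => (hy l hl).trans (revQ_mono b n l y h)

lemma revQ_update_self (b n : ℕ) (θ x : ℝ) (y : ℕ → ℝ) :
    revQ b θ (n + 1) (n + 1) (Function.update y n x) = x + θ / b := by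
  simp [revQ]

lemma revQ_update_of_le (b : ℕ) {n l : ℕ} (θ x : ℝ) (y : ℕ → ℝ) (hl : 1 ≤ l) (hln : l ≤ n) :
    revQ b θ (n + 1) l (Function.update y n x) = revQ b (x + θ / b) n l y := by
  unfold revQ
  rw [Finset.sum_Icc_succ_top (by omega), Nat.add_sub_cancel, Function.update_self,
    show n + 1 - l = n - l + 1 by omega]
  have : ∑ j ∈ Finset.Icc l n, Function.update y n x (j - 1) / (b : ℝ) ^ (j - l) =
      ∑ j ∈ Finset.Icc l n, y (j - 1) / (b : ℝ) ^ (j - l) := by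
    refine Finset.sum_congr rfl fun j hj => ?_
    rw [Finset.mem_Icc] at hj
    rw [Function.update_of_ne (by omega)]
  rw [this, add_div, pow_succ (b : ℝ) (n - l + 1), add_assoc, div_div θ, mul_comm (b : ℝ)]

lemma update_mem_tailEvent_iff (b : ℕ) {n m : ℕ} (θ x : ℝ) (y : ℕ → ℝ) (hm : 1 ≤ m)
    (hmn : m ≤ n + 1) :
    Function.update y n x ∈ tailEvent b (n + 1) m θ ↔
      1 ≤ x + θ / b ∧ y ∈ tailEvent b n m (x + θ / b) := by
  simp only [tailEvent, Set.mem_ofPred_eq, Finset.mem_Icc]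
  constructor
  · intro h
    refine ⟨?_, fun l hl => ?_⟩
    · simpa [revQ_update_self] using h (n + 1) ⟨hmn, le_rfl⟩
    · rw [← revQ_update_of_le b θ x y (hm.trans hl.1) hl.2]
      exact h l ⟨hl.1, by omega⟩
  · rintro ⟨h1, h2⟩ l ⟨hl1, hl2⟩
    rcases Nat.lt_or_ge n l with h | h
    · obtain rfl : l = n + 1 := by omega
      rwa [revQ_update_self]
    · rw [revQ_update_of_le b θ x y (hm.trans hl1) h]
      exact h2 l ⟨hl1, h⟩

/-- The reversed chain starts from the last innovation: integrating it out replaces `n + 1` and θ by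
`n` and `x + θ / b`. An event `D` that ignores this coordinate goes through unchanged. -/
lemma tailEvent_real_succ (b : ℕ) (ρ : ProbabilityMeasure ℝ) {n m : ℕ} (hm : 1 ≤ m)
    (hmn : m ≤ n + 1) {D : Set (ℕ → ℝ)} (hD : MeasurableSet D)
    (hinv : ∀ y x, Function.update y n x ∈ D ↔ y ∈ D) (θ : ℝ) :
    (seqLaw ρ).real (tailEvent b (n + 1) m θ ∩ D) =
      step b ρ (fun q => (seqLaw ρ).real (tailEvent b n m q ∩ D)) θ := by
  rw [seqLaw_real_eq_integral_update ρ n ((measurableSet_tailEvent b _ m θ).inter hD), step]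
  refine integral_congr_ae (ae_of_all _ fun x => ?_)
  simp only [Set.mem_inter_iff, hinv, update_mem_tailEvent_iff b θ x _ hm hmn]
  by_cases hx : 1 ≤ x + θ / b
  · rw [Set.indicator_of_mem (show x + θ / b ∈ Set.Ici (1 : ℝ) from hx)]
    congr 1
    ext y
    simp [hx]
  · rw [Set.indicator_of_notMem (show x + θ / b ∉ Set.Ici (1 : ℝ) from hx)]
    simp [hx]

lemma tailEvent_real_add (b : ℕ) (ρ : ProbabilityMeasure ℝ) {n m : ℕ} (hm : 1 ≤ m)
    (hmn : m ≤ n + 1) {D : Set (ℕ → ℝ)} (hD : MeasurableSet D)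
    (hinv : ∀ i, n ≤ i → ∀ y x, Function.update y i x ∈ D ↔ y ∈ D) (N : ℕ) :
    (fun θ => (seqLaw ρ).real (tailEvent b (n + N) m θ ∩ D)) =
      (step b ρ)^[N] (fun q => (seqLaw ρ).real (tailEvent b n m q ∩ D)) := by
  induction N with
  | zero => rfl
  | succ N ih =>
    rw [Function.iterate_succ_apply', ← ih]
    funext θ
    exact tailEvent_real_succ b ρ hm (hmn.trans (by gcongr; exact Nat.le_add_right n N)) hD
      (hinv _ (Nat.le_add_right n N)) θ

lemma tailEvent_eq_univ (b : ℕ) {n m : ℕ} (h : n < m) (θ : ℝ) : tailEvent b n m θ = Set.univ := by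
  simp [tailEvent, Finset.Icc_eq_empty_of_lt h]

/-- Of the `N + 1` variables the constraints ℓ ≥ 2 involve only the last `N`; Y_1 stays free. -/
lemma tailEvent_two_real (b : ℕ) (ρ : ProbabilityMeasure ℝ) (N : ℕ) (θ : ℝ) :
    (seqLaw ρ).real (tailEvent b (N + 1) 2 θ) = survival b ρ N θ := by
  have := congrFun (tailEvent_real_add b ρ (n := 1) (m := 2) (by norm_num) le_rfl
    (D := Set.univ) .univ (by simp) N) θ
  simp only [tailEvent_eq_univ b (show 1 < 2 by norm_num), Set.inter_univ, probReal_univ] at this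
  rw [add_comm, this]
  rfl

lemma tailEvent_one_real (b : ℕ) (ρ : ProbabilityMeasure ℝ) (N : ℕ) (θ : ℝ) :
    (seqLaw ρ).real (tailEvent b N 1 θ) = survival b ρ N θ := by
  have := congrFun (tailEvent_real_add b ρ (n := 0) (m := 1) le_rfl le_rfl
    (D := Set.univ) .univ (by simp) N) θ
  simp only [tailEvent_eq_univ b (show 0 < 1 by norm_num), Set.inter_univ, probReal_univ,
    zero_add] at this
  rw [this]
  rfl

/-- The tail events increase in the starting point, so intersecting with `D` can only shrink the
increments, and the Lipschitz bound is inherited from `survival`. -/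
lemma Regular.tailEvent_testFunction (h : Regular b M p ρ) (N : ℕ) {D : Set (ℕ → ℝ)}
    (hD : MeasurableSet D) :
    TestFunction M p (fun q => (seqLaw ρ).real (tailEvent b (N + 1) 2 q ∩ D)) where
  mono := fun q' q hq => measureReal_mono (Set.inter_subset_inter_left _ (tailEvent_mono b _ _ hq))
  nonneg := fun _ => measureReal_nonneg
  le_one := fun _ => measureReal_le_one
  lip := by
    intro q' q h1 h2 h3
    refine le_trans ?_ ((h.survival_testFunction N).lip q' q h1 h2 h3)
    have hsub := tailEvent_mono b (N + 1) 2 h2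
    have hm' := measurableSet_tailEvent b (N + 1) 2 q'
    rw [← tailEvent_two_real, ← tailEvent_two_real, ← measureReal_sdiff hsub hm',
      ← measureReal_sdiff (Set.inter_subset_inter_left _ hsub) (hm'.inter hD)]
    refine measureReal_mono ?_
    rintro y ⟨⟨hy1, hy2⟩, hy3⟩
    exact ⟨hy1, fun hy => hy3 ⟨hy, hy2⟩⟩

lemma condLaw_real (b : ℕ) (ρ : ProbabilityMeasure ℝ) (n : ℕ) (θ : ℝ) (D : Set (ℕ → ℝ)) :
    (condLaw b ρ n θ).real D =
      (seqLaw ρ).real (tailEvent b n 2 θ ∩ D) / (seqLaw ρ).real (tailEvent b n 2 θ) := by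
  change (ProbabilityTheory.cond (seqLaw ρ) (tailEvent b n 2 θ)).real D = _
  rw [measureReal_def, ProbabilityTheory.cond_apply (measurableSet_tailEvent b n 2 θ),
    ENNReal.toReal_mul, ENNReal.toReal_inv, div_eq_inv_mul]
  rfl

lemma Regular.isProbabilityMeasure_condLaw (h : Regular b M p ρ) (n : ℕ) {θ : ℝ} (hθ : 1 ≤ θ) :
    IsProbabilityMeasure (condLaw b ρ n θ) := by
  refine ProbabilityTheory.cond_isProbabilityMeasure ?_
  change (seqLaw ρ) (tailEvent b n 2 θ) ≠ 0
  cases n with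
  | zero => rw [tailEvent_eq_univ b (by norm_num)]; simp
  | succ n =>
    rw [← measureReal_ne_zero_iff, tailEvent_two_real]
    exact (h.survival_pos n hθ).ne'

lemma condLaw_real_add (b : ℕ) (ρ : ProbabilityMeasure ℝ) (N k : ℕ) {D : Set (ℕ → ℝ)}
    (hD : MeasurableSet D) (hinv : ∀ i, k ≤ i → ∀ y x, Function.update y i x ∈ D ↔ y ∈ D)
    (θ : ℝ) :
    (condLaw b ρ (N + (k + 1)) θ).real D =
      (step b ρ)^[N] (fun q => (seqLaw ρ).real (tailEvent b (k + 1) 2 q ∩ D)) θ /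
        survival b ρ (N + k) θ := by
  rw [condLaw_real, ← add_assoc, tailEvent_two_real]
  congr 1
  rw [← tailEvent_real_add b ρ (by norm_num) (by omega) hD (fun i hi => hinv i (by omega)),
    show N + k + 1 = k + 1 + N by omega]

/-- Conditional probabilities of cylinder events converge, to a limit that does not depend on
the starting point. -/
lemma Regular.exists_tendsto_condLaw (h : Regular b M p ρ) (k : ℕ) {D : Set (ℕ → ℝ)}
    (hD : MeasurableSet D) (hinv : ∀ i, k ≤ i → ∀ y x, Function.update y i x ∈ D ↔ y ∈ D) :
    ∃ c, ∀ θ, 1 ≤ θ → Tendsto (fun n => (condLaw b ρ n θ).real D) atTop (𝓝 c) := by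
  obtain ⟨g, K, hg0, hg1, hK, H⟩ := exists_condMean_rate M p
  have hgeo : ∀ C : ℝ, Tendsto (fun n : ℕ => C * g ^ n) atTop (𝓝 0) := fun C => by
    simpa using (tendsto_pow_atTop_nhds_zero_of_lt_one hg0.le hg1).const_mul C
  obtain ⟨l, -, hl⟩ := H h (h.tailEvent_testFunction k hD)
  obtain ⟨l', -, hl'⟩ := H h (h.survival_testFunction k)
  have lim : ∀ {f : ℝ → ℝ} {l : ℝ}, (∀ a θ, 1 ≤ θ → θ ≤ a → ∀ n : ℕ,
      |condMean b ρ f n θ - l| ≤ K a * g ^ n) → ∀ θ, 1 ≤ θ →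
      Tendsto (fun n => condMean b ρ f n θ) atTop (𝓝 l) := fun hf θ hθ =>
    tendsto_iff_norm_sub_tendsto_zero.2
      (squeeze_zero (fun _ => norm_nonneg _) (fun n => hf θ θ hθ le_rfl n) (hgeo _))
  have hl'0 : 0 < l' := (pow_pos h.pos k).trans_le
    (ge_of_tendsto' (lim hl' 1 le_rfl) fun n => h.le_condMean_survival k n le_rfl)
  refine ⟨l / l', fun θ hθ => ?_⟩
  rw [← tendsto_add_atTop_iff_nat (k + 1)]
  -- The conditional probability is a quotient of two conditional means with common denominator
  -- `survival b ρ N θ`.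
  refine ((lim hl θ hθ).div (lim hl' θ hθ) hl'0.ne').congr fun N => ?_
  rw [condLaw_real_add b ρ N k hD hinv]
  simp only [condMean, iterate_survival, Pi.div_apply]
  rw [div_div_div_cancel_right₀ (h.survival_pos N hθ).ne']

/-- The conditional law on finitely many coordinates is dominated by the unconditional one. -/
lemma Regular.condLaw_real_le (h : Regular b M p ρ) (k : ℕ) {D : Set (ℕ → ℝ)}
    (hD : MeasurableSet D) (hinv : ∀ i, k ≤ i → ∀ y x, Function.update y i x ∈ D ↔ y ∈ D)
    {n : ℕ} (hn : k + 1 ≤ n) :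
    (condLaw b ρ n 1).real D ≤ (p ^ k)⁻¹ * (seqLaw ρ).real D := by
  obtain ⟨N, rfl⟩ := Nat.exists_eq_add_of_le' hn
  have hp := h.pos
  rw [condLaw_real_add b ρ N k hD hinv, div_le_iff₀ (h.survival_pos _ le_rfl)]
  -- Dropping the last `k` constraints costs at most a factor `p ^ k` in the denominator; in the
  -- numerator it leaves the probability of `D`.
  have e1 := h.iterate_le (h.tailEvent_testFunction k hD).toUnitMonotone UnitMonotone.one
    (c := (seqLaw ρ).real D)
    (fun q _ => by simpa using measureReal_mono Set.inter_subset_right) N 1 le_rfl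
  have e2 := h.le_iterate (survival_unitMonotone b ρ k) UnitMonotone.one (c := p ^ k)
    (fun q hq => by simpa using h.pow_le_survival k hq) N 1 le_rfl
  rw [iterate_survival] at e2
  refine e1.trans ?_
  have e3 : (step b ρ)^[N] 1 1 ≤ (p ^ k)⁻¹ * survival b ρ (N + k) 1 := by
    rwa [← div_eq_inv_mul, le_div_iff₀ (pow_pos hp k), mul_comm]
  calc _ ≤ (seqLaw ρ).real D * ((p ^ k)⁻¹ * survival b ρ (N + k) 1) :=
        mul_le_mul_of_nonneg_left e3 measureReal_nonneg
    _ = _ := by ring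

lemma Regular.ae_mem_cube (h : Regular b M p ρ) :
    ∀ᵐ y ∂(seqLaw ρ), ∀ i, y i ∈ Set.Icc (0 : ℝ) 1 := by
  rw [ae_all_iff]
  intro i
  have hp := measurePreserving_eval_infinitePi (fun _ : ℕ => (ρ : Measure ℝ)) i
  exact hp.quasiMeasurePreserving.ae h.ae_mem

lemma Regular.condLaw_ae_mem_cube (h : Regular b M p ρ) (n : ℕ) (θ : ℝ) :
    ∀ᵐ y ∂(condLaw b ρ n θ), ∀ i, y i ∈ Set.Icc (0 : ℝ) 1 :=
  (ProbabilityTheory.cond_absolutelyContinuous).ae_le h.ae_mem_cube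

end Reversed

/-! ### From weak to setwise convergence under domination. -/

section WeakLimit

variable {E : Type*} [PseudoEMetricSpace E] [MeasurableSpace E] [BorelSpace E]

/-- Enclose `B` in an open set `U` with ν(U \ B) small; domination makes this excess small along the
sequence, and the portmanteau inequality applies to `U`. -/
lemma measure_le_of_tendsto_of_dominated {L : Filter ℕ} [NeBot L] {P : ℕ → ProbabilityMeasure E}
    {μ : ProbabilityMeasure E} (hP : Tendsto P L (𝓝 μ)) {ν : Measure E} [IsFiniteMeasure ν]
    (hdom : ∀ᶠ n in L, ∀ B, MeasurableSet B → (P n : Measure E) B ≤ ν B) {B : Set E}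
    (hB : MeasurableSet B) {c : ℝ≥0∞}
    (hc : Tendsto (fun n => (P n : Measure E) B) L (𝓝 c)) : (μ : Measure E) B ≤ c := by
  refine ENNReal.le_of_forall_pos_le_add fun ε hε _ => ?_
  obtain ⟨U, hBU, hU, -, hUB⟩ := hB.exists_isOpen_sdiff_lt (measure_ne_top ν B)
    (ENNReal.coe_pos.2 hε).ne'
  have hadd : Tendsto (fun n => (P n : Measure E) B + ε) L (𝓝 (c + ε)) :=
    hc.add tendsto_const_nhds
  calc (μ : Measure E) B ≤ (μ : Measure E) U := measure_mono hBU
    _ ≤ L.liminf fun n => (P n : Measure E) U :=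
        ProbabilityMeasure.le_liminf_measure_open_of_tendsto hP hU
    _ ≤ L.liminf fun n => (P n : Measure E) B + ε := by
        refine liminf_le_liminf ?_
        filter_upwards [hdom] with n hn
        calc (P n : Measure E) U ≤ (P n : Measure E) (B ∪ U \ B) := by
              rw [Set.union_sdiff_cancel hBU]
          _ ≤ (P n : Measure E) B + (P n : Measure E) (U \ B) := measure_union_le _ _
          _ ≤ _ := by
              gcongr
              exact (hn _ (hU.measurableSet.diff hB)).trans hUB.le
    _ = c + ε := hadd.liminf_eq

/-- Weak convergence of dominated probability measures is setwise convergence. -/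
lemma measure_eq_of_tendsto_of_dominated {L : Filter ℕ} [NeBot L] {P : ℕ → ProbabilityMeasure E}
    {μ : ProbabilityMeasure E} (hP : Tendsto P L (𝓝 μ)) {ν : Measure E} [IsFiniteMeasure ν]
    (hdom : ∀ᶠ n in L, ∀ B, MeasurableSet B → (P n : Measure E) B ≤ ν B) {B : Set E}
    (hB : MeasurableSet B) {c : ℝ}
    (hc : Tendsto (fun n => (P n : Measure E).real B) L (𝓝 c)) : (μ : Measure E).real B = c := by
  have key : ∀ {B : Set E} {c : ℝ}, MeasurableSet B →
      Tendsto (fun n => (P n : Measure E).real B) L (𝓝 c) → (μ : Measure E).real B ≤ c := by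
    intro B c hB hc
    have hc0 : 0 ≤ c := ge_of_tendsto' hc fun n => measureReal_nonneg
    refine ENNReal.toReal_le_of_le_ofReal hc0
      (measure_le_of_tendsto_of_dominated hP hdom hB ?_)
    refine (ENNReal.tendsto_ofReal hc).congr fun n => ?_
    rw [measureReal_def, ENNReal.ofReal_toReal (measure_ne_top _ _)]
  refine le_antisymm (key hB hc) ?_
  have := key (c := 1 - c) hB.compl
    ((tendsto_const_nhds.sub hc).congr fun n => (probReal_compl_eq_one_sub hB).symm)
  rw [probReal_compl_eq_one_sub hB] at this
  linarith

end WeakLimit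

/-! ### Existence and uniqueness of the limit law. -/

section LimitLaw

variable {b : ℕ} {M p : ℝ} {ρ : ProbabilityMeasure ℝ}

lemma measurable_initial (k : ℕ) : Measurable fun (y : ℕ → ℝ) (i : Fin k) => y i :=
  measurable_pi_lambda _ fun _ => measurable_pi_apply _

lemma update_mem_cylinder_iff {k : ℕ} {B : Set (Fin k → ℝ)} {i : ℕ} (hi : k ≤ i) (y : ℕ → ℝ)
    (x : ℝ) : Function.update y i x ∈ {y : ℕ → ℝ | (fun i : Fin k => y i) ∈ B} ↔
      y ∈ {y : ℕ → ℝ | (fun i : Fin k => y i) ∈ B} := by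
  simp only [Set.mem_ofPred_eq]
  have : (fun j : Fin k => Function.update y i x j) = fun j : Fin k => y j := by
    funext j
    rw [Function.update_of_ne (by omega)]
  rw [this]

/-- The conditional laws live on the compact cube, so they have a weak limit along an ultrafilter.
Cylinder probabilities are already known to converge, and domination identifies their limits with
those of the weak limit. -/
theorem Regular.exists_isLimitLaw (h : Regular b M p ρ) :
    ∃ μ : ProbabilityMeasure (ℕ → ℝ), IsLimitLaw b ρ μ := by
  let P : ℕ → ProbabilityMeasure (ℕ → ℝ) := fun n =>
    ⟨condLaw b ρ n 1, h.isProbabilityMeasure_condLaw n le_rfl⟩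
  let cube : Set (ℕ → ℝ) := Set.pi Set.univ fun _ => Set.Icc 0 1
  have hcube : IsCompact cube := isCompact_univ_pi fun _ => isCompact_Icc
  have hPcube : ∀ n, P n cubeᶜ = 0 := by
    intro n
    rw [ProbabilityMeasure.null_iff_toMeasure_null]
    have := h.condLaw_ae_mem_cube n 1
    rw [ae_iff] at this
    exact measure_mono_null (fun y hy hall => hy (Set.mem_univ_pi.2 hall)) this
  have hcomp : IsCompact {μ : ProbabilityMeasure (ℕ → ℝ) | ∀ n : ℕ, μ (cube)ᶜ ≤ (0 : ℝ≥0)} :=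
    isCompact_setOfPred_probabilityMeasure_mass_eq_compl_isCompact_le
      (u := fun _ => 0) (K := fun _ => cube) tendsto_const_nhds (fun _ => hcube)
      (Or.inr monotone_const)
  let U : Ultrafilter ℕ := Ultrafilter.of atTop
  have hU : (U : Filter ℕ) ≤ atTop := Ultrafilter.of_le _
  obtain ⟨μ, -, hμ⟩ := hcomp.ultrafilter_le_nhds (U.map P) (by
    rw [le_principal_iff]
    exact Filter.mem_map.2 (Filter.Eventually.of_forall fun n _ => (hPcube n).le))
  have hlim : Tendsto P (U : Filter ℕ) (𝓝 μ) := hμ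
  refine ⟨μ, fun θ hθ k B hB => ?_⟩
  have hD : MeasurableSet {y : ℕ → ℝ | (fun i : Fin k => y i) ∈ B} := measurable_initial k hB
  have hcont : Continuous fun (y : ℕ → ℝ) (i : Fin k) => y i := by fun_prop
  obtain ⟨c, hc⟩ := h.exists_tendsto_condLaw k hD fun i hi y x => update_mem_cylinder_iff hi y x
  suffices (μ : Measure (ℕ → ℝ)).real {y | (fun i : Fin k => y i) ∈ B} = c by
    rw [this]
    exact hc θ hθ
  have hlim' := ProbabilityMeasure.tendsto_map_of_tendsto_of_continuous P μ hlim hcont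
  have hp := h.pos
  let ν : Measure (Fin k → ℝ) :=
    ENNReal.ofReal (p ^ k)⁻¹ • (seqLaw ρ).map fun (y : ℕ → ℝ) (i : Fin k) => y i
  have : IsFiniteMeasure ν := by
    refine Measure.smul_finite _ ENNReal.ofReal_ne_top
  have hmap : ∀ (σ : ProbabilityMeasure (ℕ → ℝ)) {B : Set (Fin k → ℝ)}, MeasurableSet B →
      ((σ.map hcont.measurable.aemeasurable : ProbabilityMeasure (Fin k → ℝ)) :
        Measure (Fin k → ℝ)) B =
        (σ : Measure (ℕ → ℝ)) {y : ℕ → ℝ | (fun i : Fin k => y i) ∈ B} := fun σ B hB => by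
    rw [ProbabilityMeasure.toMeasure_map, Measure.map_apply hcont.measurable hB]
    rfl
  have hfin := measure_eq_of_tendsto_of_dominated (ν := ν) hlim'
    (hU ((eventually_ge_atTop (k + 1)).mono fun n hn B hB => ?_)) hB (c := c) ?_
  · rwa [measureReal_def, hmap μ hB] at hfin
  · have hD' : MeasurableSet {y : ℕ → ℝ | (fun i : Fin k => y i) ∈ B} := measurable_initial k hB
    have e1 := h.condLaw_real_le k hD' (fun i hi y x => update_mem_cylinder_iff hi y x) hn
    rw [hmap _ hB]
    change (condLaw b ρ n 1) _ ≤ _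
    have := h.isProbabilityMeasure_condLaw n (le_refl (1 : ℝ))
    rw [Measure.smul_apply, Measure.map_apply hcont.measurable hB, smul_eq_mul,
      ← ENNReal.ofReal_toReal (measure_ne_top (condLaw b ρ n 1) _),
      ← ENNReal.ofReal_toReal (measure_ne_top (seqLaw ρ) _),
      ← ENNReal.ofReal_mul (by positivity)]
    exact ENNReal.ofReal_le_ofReal e1
  · refine ((hc 1 le_rfl).mono_left hU).congr fun n => ?_
    rw [measureReal_def, measureReal_def, hmap _ hB]
    rfl

theorem IsLimitLaw.unique {μ ν : ProbabilityMeasure (ℕ → ℝ)} (hμ : IsLimitLaw b ρ μ)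
    (hν : IsLimitLaw b ρ ν) : ν = μ := by
  apply Subtype.ext
  refine IsProjectiveLimit.unique (P := fun I => (μ : Measure (ℕ → ℝ)).map I.restrict)
    (fun I => ?_) (fun I => rfl)
  ext B hB
  rw [Measure.map_apply (Finset.measurable_restrict I) hB,
    Measure.map_apply (Finset.measurable_restrict I) hB]
  have hlt : ∀ i : I, (i : ℕ) < I.sup id + 1 := fun i =>
    Nat.lt_succ_of_le (Finset.le_sup (f := id) i.2)
  let r : (Fin (I.sup id + 1) → ℝ) → (I → ℝ) := fun v i => v ⟨i, hlt i⟩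
  have hr : Measurable r := measurable_pi_lambda _ fun i => measurable_pi_apply _
  have h1 := hμ 1 le_rfl _ _ (hr hB)
  have h2 := hν 1 le_rfl _ _ (hr hB)
  have h3 := tendsto_nhds_unique h2 h1
  rw [measureReal_def, measureReal_def,
    ENNReal.toReal_eq_toReal_iff' (measure_ne_top _ _) (measure_ne_top _ _)] at h3
  exact h3

end LimitLaw

/-! ### Identification of `z` through `Qinf`. -/

section Qinf

variable {b : ℕ} {M p : ℝ} {ρ : ProbabilityMeasure ℝ}

/-- The partial sums of `Qinf`. -/
noncomputable def partialQ (b k : ℕ) (y : ℕ → ℝ) : ℝ := ∑ j ∈ Finset.range k, y j / (b : ℝ) ^ j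

lemma measurable_partialQ (b k : ℕ) : Measurable (partialQ b k) := by
  unfold partialQ
  fun_prop

lemma revQ_one (b : ℕ) (θ : ℝ) {n : ℕ} (hn : 1 ≤ n) (y : ℕ → ℝ) :
    revQ b θ n 1 y = partialQ b n y + θ / (b : ℝ) ^ n := by
  unfold revQ partialQ
  rw [Nat.sub_add_cancel hn, Finset.range_eq_Ico, ← Finset.Ico_add_one_right_eq_Icc,
    Finset.sum_Ico_add' (fun j => y (j - 1) / (b : ℝ) ^ (j - 1)) 0 n 1 |>.symm]
  simp

lemma partialQ_mono (b : ℕ) {y : ℕ → ℝ} (hy : ∀ i, y i ∈ Set.Icc (0 : ℝ) 1) :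
    Monotone fun k => partialQ b k y := by
  refine monotone_nat_of_le_succ fun k => ?_
  unfold partialQ
  rw [Finset.sum_range_succ]
  have : 0 ≤ y k / (b : ℝ) ^ k := div_nonneg (hy k).1 (by positivity)
  linarith

/-- The term 2/b^k dominates the remaining geometric series, because b/(b - 1) ≤ 2. -/
lemma partialQ_add_antitone (hb : 2 ≤ b) {y : ℕ → ℝ} (hy : ∀ i, y i ∈ Set.Icc (0 : ℝ) 1) :
    Antitone fun k => partialQ b k y + 2 / (b : ℝ) ^ k := by
  have hb' : (2 : ℝ) ≤ b := by exact_mod_cast hb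
  have hb0 : (0 : ℝ) < b := by linarith
  refine antitone_nat_of_succ_le fun k => ?_
  unfold partialQ
  rw [Finset.sum_range_succ]
  have e1 : y k / (b : ℝ) ^ k ≤ 1 / (b : ℝ) ^ k := by
    gcongr
    exact (hy k).2
  have e2 : 2 / (b : ℝ) ^ (k + 1) ≤ 1 / (b : ℝ) ^ k := by
    rw [pow_succ, div_le_div_iff₀ (by positivity) (by positivity)]
    nlinarith [pow_pos hb0 k]
  have e3 : 2 / (b : ℝ) ^ k = 1 / (b : ℝ) ^ k + 1 / (b : ℝ) ^ k := by ring
  linarith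

lemma tendsto_partialQ (hb : 2 ≤ b) {y : ℕ → ℝ} (hy : ∀ i, y i ∈ Set.Icc (0 : ℝ) 1) :
    Tendsto (fun k => partialQ b k y) atTop (𝓝 (Qinf b y)) := by
  have hb' : (2 : ℝ) ≤ b := by exact_mod_cast hb
  have hs : Summable fun k : ℕ => y k / (b : ℝ) ^ k := by
    refine Summable.of_nonneg_of_le (fun k => div_nonneg (hy k).1 (by positivity)) (fun k => ?_)
      summable_geometric_two
    rw [one_div, inv_pow, ← one_div]
    gcongr
    exact (hy k).2
  exact hs.hasSum.tendsto_sum_nat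

lemma partialQ_le_Qinf (hb : 2 ≤ b) {y : ℕ → ℝ} (hy : ∀ i, y i ∈ Set.Icc (0 : ℝ) 1) (k : ℕ) :
    partialQ b k y ≤ Qinf b y :=
  ge_of_tendsto (tendsto_partialQ hb hy)
    ((eventually_ge_atTop k).mono fun _ hn => partialQ_mono b hy hn)

lemma Qinf_le_partialQ_add (hb : 2 ≤ b) {y : ℕ → ℝ} (hy : ∀ i, y i ∈ Set.Icc (0 : ℝ) 1) (k : ℕ) :
    Qinf b y ≤ partialQ b k y + 2 / (b : ℝ) ^ k := by
  refine le_of_tendsto (tendsto_partialQ hb hy) ((eventually_ge_atTop k).mono fun n hn => ?_)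
  have h1 : partialQ b n y + 2 / (b : ℝ) ^ n ≤ partialQ b k y + 2 / (b : ℝ) ^ k :=
    partialQ_add_antitone hb hy hn
  have h2 : 0 ≤ 2 / (b : ℝ) ^ n := by positivity
  linarith

/-- The first coordinate is independent of the conditioning, so its law has a bounded density. -/
lemma Regular.condLaw_partialQ_le (h : Regular b M p ρ) (n : ℕ) {θ : ℝ} (hθ : 1 ≤ θ) {k : ℕ}
    (hk : 1 ≤ k) {a c : ℝ} (hac : a ≤ c) :
    (condLaw b ρ n θ).real {y | partialQ b k y ∈ Set.Ico a c} ≤ M * (c - a) := by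
  have hM := h.half_le
  have hMac : 0 ≤ M * (c - a) := mul_nonneg (by linarith) (by linarith)
  have hD : MeasurableSet {y : ℕ → ℝ | partialQ b k y ∈ Set.Ico a c} :=
    measurable_partialQ b k measurableSet_Ico
  have hT := measurableSet_tailEvent b n 2 θ
  have hprob := h.isProbabilityMeasure_condLaw n hθ
  have hpos : (seqLaw ρ).real (tailEvent b n 2 θ) ≠ 0 := by
    intro h0
    have := condLaw_real b ρ n θ Set.univ
    rw [h0, div_zero, probReal_univ] at this
    exact one_ne_zero this
  rw [condLaw_real, div_le_iff₀ (lt_of_le_of_ne measureReal_nonneg hpos.symm)]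
  have hupd : ∀ (y : ℕ → ℝ) (x : ℝ),
      Function.update y 0 x ∈ tailEvent b n 2 θ ↔ y ∈ tailEvent b n 2 θ := by
    intro y x
    refine forall₂_congr fun l hl => ?_
    rw [Finset.mem_Icc] at hl
    have : revQ b θ n l (Function.update y 0 x) = revQ b θ n l y := by
      unfold revQ
      congr 1
      refine Finset.sum_congr rfl fun j hj => ?_
      rw [Finset.mem_Icc] at hj
      rw [Function.update_of_ne (by omega)]
    rw [this]
  have hsum : ∀ (y : ℕ → ℝ) (x : ℝ),
      partialQ b k (Function.update y 0 x) = x + (partialQ b k y - y 0) := by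
    intro y x
    obtain ⟨j, rfl⟩ := Nat.exists_eq_add_of_le' hk
    unfold partialQ
    rw [Finset.sum_range_succ', Finset.sum_range_succ']
    simp
    ring
  have key : (seqLaw ρ) (tailEvent b n 2 θ ∩ {y | partialQ b k y ∈ Set.Ico a c}) ≤
      ENNReal.ofReal (M * (c - a)) * (seqLaw ρ) (tailEvent b n 2 θ) := by
    -- Resample Y_1 and integrate over it first: for frozen other coordinates it must fall in a
    -- translate of `[a, c)`.
    conv_lhs => rw [← map_update_seqLaw ρ 0]
    rw [Measure.map_apply (measurable_update 0) (hT.inter hD),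
      Measure.prod_apply_symm (measurable_update 0 (hT.inter hD)), ← lintegral_indicator_const hT]
    refine lintegral_mono fun y => ?_
    by_cases hy : y ∈ tailEvent b n 2 θ
    · rw [Set.indicator_of_mem hy]
      have e1 := h.Ico_le (a - (partialQ b k y - y 0)) (c - (partialQ b k y - y 0)) (by linarith)
      calc _ ≤ (ρ : Measure ℝ)
            (Set.Ico (a - (partialQ b k y - y 0)) (c - (partialQ b k y - y 0))) := by
            refine measure_mono fun x hx => ?_
            have hx2 : partialQ b k (Function.update y 0 x) ∈ Set.Ico a c := hx.2
            rw [hsum] at hx2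
            constructor <;> linarith [hx2.1, hx2.2]
        _ ≤ _ := by
            rw [← ENNReal.ofReal_toReal (measure_ne_top (ρ : Measure ℝ) _)]
            refine ENNReal.ofReal_le_ofReal (e1.trans (le_of_eq ?_))
            ring
    · rw [Set.indicator_of_notMem hy, nonpos_iff_eq_zero]
      convert measure_empty (μ := (ρ : Measure ℝ))
      rw [Set.eq_empty_iff_forall_notMem]
      intro x hx
      exact hy ((hupd y x).1 hx.1)
  have := ENNReal.toReal_mono (ENNReal.mul_ne_top ENNReal.ofReal_ne_top (measure_ne_top _ _)) key
  rwa [ENNReal.toReal_mul, ENNReal.toReal_ofReal hMac] at this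

/-- Adding the constraint ℓ = 1 to those with ℓ ≥ 2 gives full survival, so the conditional
probability is a ratio of consecutive survival probabilities. -/
lemma Regular.tendsto_condLaw_revQ (h : Regular b M p ρ) :
    Tendsto (fun n => (condLaw b ρ n 1).real {y | 1 ≤ revQ b 1 n 1 y}) atTop (𝓝 (z b ρ)) := by
  rw [← tendsto_add_atTop_iff_nat 1]
  refine (h.tendsto_survival_ratio_z le_rfl).congr fun n => ?_
  rw [condLaw_real, tailEvent_two_real, ← tailEvent_one_real]
  congr 2
  ext y
  simp only [tailEvent, Finset.mem_Icc, Set.mem_ofPred_eq, Set.mem_inter_iff]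
  constructor
  · intro hy
    exact ⟨fun l hl => hy l ⟨by omega, hl.2⟩, hy 1 ⟨le_rfl, by omega⟩⟩
  · rintro ⟨h1, h2⟩ l hl
    rcases hl.1.lt_or_eq with h3 | h3
    · exact h1 l ⟨h3, hl.2⟩
    · exact h3 ▸ h2

lemma IsLimitLaw.tendsto_partialQ_mem {μ : ProbabilityMeasure (ℕ → ℝ)} (hμ : IsLimitLaw b ρ μ)
    (k : ℕ) {S : Set ℝ} (hS : MeasurableSet S) :
    Tendsto (fun n => (condLaw b ρ n 1).real {y | partialQ b k y ∈ S}) atTop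
      (𝓝 ((μ : Measure (ℕ → ℝ)).real {y | partialQ b k y ∈ S})) := by
  have := hμ 1 le_rfl k ((fun v : Fin k → ℝ => ∑ i : Fin k, v i / (b : ℝ) ^ (i : ℕ)) ⁻¹' S)
    ((by fun_prop : Measurable fun v : Fin k → ℝ => ∑ i : Fin k, v i / (b : ℝ) ^ (i : ℕ)) hS)
  simpa only [partialQ, Finset.sum_range, Set.mem_preimage] using this

lemma IsLimitLaw.ae_mem_cube (h : Regular b M p ρ) {μ : ProbabilityMeasure (ℕ → ℝ)}
    (hμ : IsLimitLaw b ρ μ) : ∀ᵐ y ∂(μ : Measure (ℕ → ℝ)), ∀ i, y i ∈ Set.Icc (0 : ℝ) 1 := by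
  rw [ae_all_iff]
  intro i
  have hlim := hμ 1 le_rfl (i + 1) ((fun v : Fin (i + 1) → ℝ => v (Fin.last i)) ⁻¹' (Set.Icc 0 1)ᶜ)
    (measurable_pi_apply _ measurableSet_Icc.compl)
  have hzero : ∀ n, (condLaw b ρ n 1).real {y | (fun j : Fin (i + 1) => y j) ∈
      (fun v : Fin (i + 1) → ℝ => v (Fin.last i)) ⁻¹' (Set.Icc 0 1)ᶜ} = 0 := by
    intro n
    have hprob := h.isProbabilityMeasure_condLaw n (le_refl (1 : ℝ))
    have := h.condLaw_ae_mem_cube n 1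
    rw [ae_iff] at this
    rw [measureReal_eq_zero_iff]
    refine measure_mono_null (fun y hy => ?_) this
    have hy' : y i ∉ Set.Icc (0 : ℝ) 1 := hy
    exact fun hall => hy' (hall i)
  simp only [hzero] at hlim
  have := tendsto_nhds_unique hlim tendsto_const_nhds
  rw [measureReal_eq_zero_iff] at this
  exact this

/-- The decay rate is the probability of `Qinf ≥ 1` under the limit law. -/
theorem IsLimitLaw.z_eq (h : Regular b M p ρ) {μ : ProbabilityMeasure (ℕ → ℝ)}
    (hμ : IsLimitLaw b ρ μ) :
    z b ρ = (μ : Measure (ℕ → ℝ)).real {y | 1 ≤ Qinf b y} := by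
  have hb := h.two_le_cast
  have hb0 : (0 : ℝ) < b := by linarith
  have hM := h.half_le
  have hcube := hμ.ae_mem_cube h
  have hbound : ∀ k : ℕ, |z b ρ - (μ : Measure (ℕ → ℝ)).real {y | 1 ≤ Qinf b y}| ≤
      M * (3 / (b : ℝ) ^ (k + 1)) := by
    intro k
    -- ε covers the remainder of the series after `k + 1` terms, including the contribution of the
    -- starting point. Both sides then lie between the probabilities that the partial sum is at
    -- least 1 and at least 1 - ε.
    set ε : ℝ := 3 / (b : ℝ) ^ (k + 1) with hε
    have hε0 : 0 ≤ ε := by positivity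
    have hε1 : 2 / (b : ℝ) ^ (k + 1) + 1 / (b : ℝ) ^ (k + 1) = ε := by rw [hε]; ring
    have hε2 : 0 ≤ 1 / (b : ℝ) ^ (k + 1) := by positivity
    have hA := hμ.tendsto_partialQ_mem (k + 1) (measurableSet_Ici (a := (1 : ℝ)))
    have hA' := hμ.tendsto_partialQ_mem (k + 1) (measurableSet_Ici (a := 1 - ε))
    have hI := hμ.tendsto_partialQ_mem (k + 1) (measurableSet_Ico (a := 1 - ε) (b := (1 : ℝ)))
    have hmain := h.tendsto_condLaw_revQ
    have fin : ∀ n, IsProbabilityMeasure (condLaw b ρ n 1) := fun n =>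
      h.isProbabilityMeasure_condLaw n le_rfl
    have hsmall : (μ : Measure (ℕ → ℝ)).real {y | partialQ b (k + 1) y ∈ Set.Ico (1 - ε) 1} ≤
        M * ε := by
      refine le_of_tendsto' hI fun n => ?_
      simpa using h.condLaw_partialQ_le n le_rfl (Nat.le_add_left 1 k)
        (by linarith : 1 - ε ≤ (1 : ℝ))
    have hlow : (μ : Measure (ℕ → ℝ)).real {y | partialQ b (k + 1) y ∈ Set.Ici 1} ≤ z b ρ := by
      refine le_of_tendsto_of_tendsto hA hmain
        ((eventually_ge_atTop (k + 1)).mono fun n hn => ?_)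
      refine ENNReal.toReal_mono (measure_ne_top _ _) (measure_mono_ae ?_)
      filter_upwards [h.condLaw_ae_mem_cube n 1] with y hy hy1
      change 1 ≤ revQ b 1 n 1 y
      have e1 : partialQ b (k + 1) y ≤ partialQ b n y := partialQ_mono b hy hn
      have e2 : 0 ≤ 1 / (b : ℝ) ^ n := by positivity
      have e3 : 1 ≤ partialQ b (k + 1) y := hy1
      rw [revQ_one b 1 (by omega)]
      linarith
    have hup : z b ρ ≤ (μ : Measure (ℕ → ℝ)).real {y | partialQ b (k + 1) y ∈ Set.Ici (1 - ε)} := by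
      refine le_of_tendsto_of_tendsto hmain hA'
        ((eventually_ge_atTop (k + 1)).mono fun n hn => ?_)
      refine ENNReal.toReal_mono (measure_ne_top _ _) (measure_mono_ae ?_)
      filter_upwards [h.condLaw_ae_mem_cube n 1] with y hy hy1
      change 1 - ε ≤ partialQ b (k + 1) y
      have e1 : partialQ b n y + 2 / (b : ℝ) ^ n ≤
        partialQ b (k + 1) y + 2 / (b : ℝ) ^ (k + 1) := partialQ_add_antitone h.two_le hy hn
      have e2 : 0 ≤ 1 / (b : ℝ) ^ n := by positivity
      have e3 : 1 ≤ revQ b 1 n 1 y := hy1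
      have e4 : 2 / (b : ℝ) ^ n = 1 / (b : ℝ) ^ n + 1 / (b : ℝ) ^ n := by ring
      rw [revQ_one b 1 (by omega)] at e3
      linarith
    have hlow' : (μ : Measure (ℕ → ℝ)).real {y | partialQ b (k + 1) y ∈ Set.Ici 1} ≤
        (μ : Measure (ℕ → ℝ)).real {y | 1 ≤ Qinf b y} := by
      refine ENNReal.toReal_mono (measure_ne_top _ _) (measure_mono_ae ?_)
      filter_upwards [hcube] with y hy hy1
      exact le_trans (show 1 ≤ partialQ b (k + 1) y from hy1) (partialQ_le_Qinf h.two_le hy _)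
    have hup' : (μ : Measure (ℕ → ℝ)).real {y | 1 ≤ Qinf b y} ≤
        (μ : Measure (ℕ → ℝ)).real {y | partialQ b (k + 1) y ∈ Set.Ici (1 - ε)} := by
      refine ENNReal.toReal_mono (measure_ne_top _ _) (measure_mono_ae ?_)
      filter_upwards [hcube] with y hy hy1
      change 1 - ε ≤ partialQ b (k + 1) y
      have e1 : 1 ≤ Qinf b y := hy1
      have e2 := Qinf_le_partialQ_add h.two_le hy (k + 1)
      linarith
    have hsplit : (μ : Measure (ℕ → ℝ)).real {y | partialQ b (k + 1) y ∈ Set.Ici (1 - ε)} ≤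
        (μ : Measure (ℕ → ℝ)).real {y | partialQ b (k + 1) y ∈ Set.Ico (1 - ε) 1} +
        (μ : Measure (ℕ → ℝ)).real {y | partialQ b (k + 1) y ∈ Set.Ici 1} := by
      refine (measureReal_mono ?_).trans (measureReal_union_le _ _)
      intro y hy
      rcases lt_or_ge (partialQ b (k + 1) y) 1 with h1 | h1
      · exact Or.inl ⟨hy, h1⟩
      · exact Or.inr h1
    rw [abs_le]
    constructor <;> linarith
  have hlim : Tendsto (fun k : ℕ => M * (3 / (b : ℝ) ^ (k + 1))) atTop (𝓝 0) := by
    have e1 : Tendsto (fun k : ℕ => (b : ℝ) ^ (k + 1)) atTop atTop :=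
      (tendsto_pow_atTop_atTop_of_one_lt (by linarith)).comp (tendsto_add_atTop_nat 1)
    simpa using (tendsto_const_nhds.div_atTop e1).const_mul M
  have := ge_of_tendsto' hlim hbound
  rw [← sub_eq_zero, ← abs_nonpos_iff]
  exact this

end Qinf

end Avalanche

/-! ### Assembly and choice of the constants. -/

theorem corollary3p7 (b : ℕ) (hb : 2 ≤ b) :
    -- the functional z is well defined, the limit law exists and is unique, z = P(Q_∞ ≥ 1)
    (∀ ρ ∈ Avalanche.BoundedDensity b,
      (∀ θ : ℝ, 1 ≤ θ →
        Tendsto (fun n : ℕ => Avalanche.Z b ρ n θ ^ (1 / (n : ℝ))) atTop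
          (𝓝 (Avalanche.z b ρ))) ∧
      ∃ μ : ProbabilityMeasure (ℕ → ℝ), Avalanche.IsLimitLaw b ρ μ ∧
        (∀ ν : ProbabilityMeasure (ℕ → ℝ), Avalanche.IsLimitLaw b ρ ν → ν = μ) ∧
        Avalanche.z b ρ = (μ : Measure (ℕ → ℝ)).real {y | 1 ≤ Avalanche.Qinf b y}) ∧
    -- existence of the limit psi
    (∀ ρ ∈ Avalanche.BoundedDensity b, ∀ θ : ℝ, 0 ≤ θ →
      Tendsto (fun n : ℕ => Avalanche.Z b ρ n θ * (Avalanche.z b ρ ^ n)⁻¹) atTop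
        (𝓝 (Avalanche.psi b ρ θ))) ∧
    -- positivity, vanishing below 1, monotonicity
    (∀ ρ ∈ Avalanche.BoundedDensity b,
      (∀ θ : ℝ, 1 ≤ θ → 0 < Avalanche.psi b ρ θ) ∧
      (∀ θ : ℝ, θ < 1 → Avalanche.psi b ρ θ = 0) ∧
      MonotoneOn (Avalanche.psi b ρ) (Set.Ici 1)) ∧
    -- continuity along convex interpolations
    (∀ ρ ∈ Avalanche.BoundedDensity b, ∀ ρ' ∈ Avalanche.BoundedDensity b, ∀ θ : ℝ, 0 ≤ θ →
      Continuous (fun α : Set.Icc (0 : ℝ) 1 => Avalanche.psi b (Avalanche.mix ρ ρ' α) θ)) ∧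
    -- exponential error bound and Lipschitz bound, with locally uniform constants
    ∃ (A C : ProbabilityMeasure ℝ → ℝ → ℝ) (ζ : ProbabilityMeasure ℝ → ℝ),
      (∀ ρ ∈ Avalanche.BoundedDensity b, 0 < ζ ρ ∧
        ∀ θ₀ : ℝ, Avalanche.thetaB b ρ < θ₀ →
          (∀ θ ∈ Set.Icc (0 : ℝ) θ₀, ∀ n : ℕ, 1 ≤ n →
            |Avalanche.Z b ρ n θ * (Avalanche.z b ρ ^ n)⁻¹ - Avalanche.psi b ρ θ|
              ≤ A ρ θ₀ * Real.exp (-(ζ ρ * (n : ℝ)))) ∧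
          (∀ θ ∈ Set.Icc (1 : ℝ) θ₀, ∀ θ' ∈ Set.Icc (1 : ℝ) θ₀,
            |Avalanche.psi b ρ θ - Avalanche.psi b ρ θ'|
              ≤ C ρ θ₀ * Avalanche.psi b ρ θ₀ * |θ - θ'|)) ∧
      (∀ (m : ℕ) (σ : Fin m → ProbabilityMeasure ℝ),
        (∀ i, σ i ∈ Avalanche.BoundedDensity b) →
        (∃ c c' : ℝ, 0 < c ∧ ∀ ρ ∈ Avalanche.hull σ, c ≤ ζ ρ ∧ ζ ρ ≤ c') ∧
        ∀ θ₀ : ℝ, ∃ c c' : ℝ, 0 < c ∧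
          ∀ ρ ∈ Avalanche.hull σ, Avalanche.thetaB b ρ < θ₀ →
            (c ≤ A ρ θ₀ ∧ A ρ θ₀ ≤ c') ∧ (c ≤ C ρ θ₀ ∧ C ρ θ₀ ≤ c')) := by
  classical
  choose ζ K A hζ hA H using fun k : ℕ =>
    Avalanche.exists_rate_bounds (k : ℝ) (1 / ((k : ℝ) + 1))
  have hA' : ∀ (k : ℕ) a, 0 < A k a := fun k a => hA k a (by positivity) (by positivity)
  -- `k + 1` in place of `k` keeps the constant positive at `k = 0`, as the lower bounds over all `k
  -- ≤ N` require.
  let C : ℕ → ℝ := fun k => 4 * ((k : ℝ) + 1) / (1 / ((k : ℝ) + 1))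
  have hC : ∀ k, 0 < C k := fun k => by positivity
  let Reg : ProbabilityMeasure ℝ → ℕ → Prop := fun ρ k =>
    Avalanche.Regular b k (1 / ((k : ℝ) + 1)) ρ
  let κ : ProbabilityMeasure ℝ → ℕ := fun ρ => sInf {k | Reg ρ k}
  have hκ : ∀ ρ ∈ Avalanche.BoundedDensity b, Reg ρ (κ ρ) := fun ρ hρ =>
    Nat.sInf_mem (Avalanche.exists_regular hb hρ)
  have hbounds : ∀ (f : ℕ → ℝ) (N : ℕ), (∀ k, 0 < f k) →
      ∃ c c' : ℝ, 0 < c ∧ ∀ k ≤ N, c ≤ f k ∧ f k ≤ c' := by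
    intro f N hf
    have hne : (Finset.range (N + 1)).Nonempty := ⟨0, by simp⟩
    refine ⟨(Finset.range (N + 1)).inf' hne f, (Finset.range (N + 1)).sup' hne f,
      (Finset.lt_inf'_iff hne).2 fun k _ => hf k, fun k hk => ?_⟩
    have : k ∈ Finset.range (N + 1) := Finset.mem_range.2 (by omega)
    exact ⟨Finset.inf'_le f this, Finset.le_sup' f this⟩
  refine ⟨?_, ?_, ?_, ?_, fun ρ θ₀ => A (κ ρ) θ₀, fun ρ _ => C (κ ρ), fun ρ => ζ (κ ρ), ?_, ?_⟩
  · intro ρ hρ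
    have h := hκ ρ hρ
    obtain ⟨μ, hμ⟩ := h.exists_isLimitLaw
    exact ⟨(H _ h).2.1, μ, hμ, fun ν hν => hμ.unique hν, hμ.z_eq h⟩
  · intro ρ hρ θ _
    exact (hκ ρ hρ).tendsto_psi θ
  · intro ρ hρ
    have h := hκ ρ hρ
    exact ⟨(H _ h).2.2.2.2.1, (H _ h).2.2.2.2.2, h.psi_monotoneOn⟩
  · intro ρ hρ ρ' hρ' θ _
    exact Avalanche.continuous_psi_mix hb hρ hρ' θ
  · intro ρ hρ
    have h := hκ ρ hρ
    refine ⟨hζ _, fun θ₀ _ => ⟨fun θ hθ n _ => (H _ h).2.2.2.1 θ₀ θ hθ.2 n,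
      fun θ hθ θ' hθ' => ?_⟩⟩
    refine (h.mono (le_add_of_nonneg_right zero_le_one) h.pos le_rfl).abs_psi_sub_le hθ hθ'
  · intro m σ hσ
    -- The largest index among the `σ i` is admissible for the whole hull and `κ` is minimal, so
    -- only finitely many constants occur there.
    have hκN : ∀ ρ ∈ Avalanche.hull σ, κ ρ ≤ Finset.univ.sup fun i => κ (σ i) := by
      intro ρ hρ
      refine Nat.sInf_le (Avalanche.regular_of_mem_hull hb (by positivity) (fun i => ?_) hρ)
      exact Avalanche.regular_mono (hκ _ (hσ i))
        (Finset.le_sup (f := fun i => κ (σ i)) (Finset.mem_univ i))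
    refine ⟨?_, fun θ₀ => ?_⟩
    · obtain ⟨c, c', hc, hcc⟩ := hbounds ζ _ hζ
      exact ⟨c, c', hc, fun ρ hρ => hcc _ (hκN ρ hρ)⟩
    · obtain ⟨c₁, c₁', hc₁, hcc₁⟩ := hbounds (fun k => A k θ₀) _ fun k => hA' k θ₀
      obtain ⟨c₂, c₂', hc₂, hcc₂⟩ := hbounds C _ hC
      refine ⟨min c₁ c₂, max c₁' c₂', lt_min hc₁ hc₂, fun ρ hρ _ => ?_⟩
      have e1 := hcc₁ _ (hκN ρ hρ)
      have e2 := hcc₂ _ (hκN ρ hρ)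
      exact ⟨⟨(min_le_left _ _).trans e1.1, e1.2.trans (le_max_left _ _)⟩,
        ⟨(min_le_right _ _).trans e2.1, e2.2.trans (le_max_right _ _)⟩⟩
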